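/- Let $(\Omega,\mathcal F,\mathbb P)$ be an atomless probability space, let $\Theta\subset\mathbb R^m$ be nonempty and compact, let $Z$ be an $\mathbb R^d$-valued random vector with law $\mathbb P^Z$, and let $Z_1,Z_2,\dots$ be independent random vectors on $(\Omega,\mathcal F,\mathbb P)$ with the same law as $Z$. Let $\Phi:[0,\infty[\to[0,\infty]$ be lower semicontinuous and convex with $\Phi(0)<\infty$, $\Phi(x_0)<\infty$ for some $x_0>1$, $\inf_{x\ge 0}\Phi(x)=0$ and $\lim_{x\to\infty}\Phi(x)/x=\infty$, and let $\Phi^*(y)=\sup_{x\ge 0}(xy-\Phi(x))$, $y\in\mathbb R$ (a finite function). Let $H^{\Phi^*}$ be the set of random variables $X$ on $\Omega$ with $\mathbb E[\Phi^*(c|X|)]<\infty$ for all $c>0$, and for $X\in H^{\Phi^*}$ put $$\rho^\Phi(X)=\sup_{Q\in\mathcal P_\Phi}\Big(\mathbb E_Q[X]-\mathbb E\big[\Phi\big(\tfrac{dQ}{d\mathbb P}\big)\big]\Big),$$ where $\mathcal P_\Phi$ is the set of probability measures $Q\ll\mathbb P$ with $\mathbb E[\Phi(dQ/d\mathbb P)]<\infty$.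 This functional is law-invariant; for the distribution function $F$ of some $X\in H^{\Phi^*}$ write $\mathcal R(F)=\rho^\Phi(X)$. For such $F$ let $M_F$ be the set of minimizers over $x\in\mathbb R$ of $x\mapsto\int_0^1\Phi^*(F^{\leftarrow}(u)+x)\,du-x$, where $F^{\leftarrow}$ is the left-continuous quantile function of $F$ (the infimum of this function is $\mathcal R(F)$). Let $G:\Theta\times\mathbb R^d\to\mathbb R$ satisfy: (A1) $G$ is measurable with respect to $\mathcal B(\Theta)\otimes\mathcal B(\mathbb R^d)$, and $G(\cdot,z)$ is lower semicontinuous for every $z\in\mathbb R^d$; (A2) there is a $\mathbb P^Z$-integrable $\xi_1:\mathbb R^d\to\mathbb R$ with $\sup_{\theta\in\Theta}|G(\theta,z)|\le\xi_1(z)$ for all $z\in\mathbb R^d$; (A3) $G(\theta,Z_1)\in H^{\Phi^*}$ for every $\theta\in\Theta$, and there is a $\mathbb P^Z$-integrable $\xi_2:\mathbb R^d\to\mathbb R$ with $\sup_{\theta\in\Theta}|\Phi^*(G(\theta,z))|\le\xi_2(z)$ for all $z\in\mathbb R^d$. Let $F_\theta$ be the distribution function of $G(\theta,Z)$, and let $\widehat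 F_{n,\theta}(t)=\frac1n\sum_{j=1}^n\mathbf 1_{]-\infty,t]}(G(\theta,Z_j))$ for $n\ge 1$. Then: 1) the optimal values $\inf_{\theta\in\Theta}\mathcal R(F_\theta)$ and $\inf_{\theta\in\Theta}\mathcal R(\widehat F_{n,\theta})(\omega)$ ($n\ge1$, $\omega\in\Omega$) are real numbers, and for every $n\ge 1$ the difference $\inf_{\theta\in\Theta}\mathcal R(\widehat F_{n,\theta})-\inf_{\theta\in\Theta}\mathcal R(F_\theta)$ is an $\mathcal F$-measurable random variable; 2) the set of minimizers of $\theta\mapsto\mathcal R(F_\theta)$ over $\Theta$ is nonempty and compact, and for every $\theta\in\Theta$ the set $M_{F_\theta}$ is nonempty and compact; 3) there is $A\in\mathcal F$ with $\mathbb P(A)=1$ such that $\inf_{\theta\in\Theta}\mathcal R(\widehat F_{n,\theta})(\omega)\to\inf_{\theta\in\Theta}\mathcal R(F_\theta)$ as $n\to\infty$ for every $\omega\in A$. -/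

import Mathlib

open MeasureTheory ProbabilityTheory Filter Topology
open scoped NNReal ENNReal

noncomputable section

/-- The standing assumptions on a divergence function `Φ : [0,∞[ → [0,∞]`. -/
structure IsDivergenceFunction (Φ : ℝ≥0 → ℝ≥0∞) : Prop where
  lsc : LowerSemicontinuous Φ
  convex : ConvexOn ℝ≥0 Set.univ Φ
  zero_lt_top : Φ 0 < ⊤
  exists_lt_top : ∃ x₀ : ℝ≥0, 1 < x₀ ∧ Φ x₀ < ⊤
  iInf_eq_zero : ⨅ x, Φ x = 0
  growth : Tendsto (fun x : ℝ≥0 => Φ x / (x : ℝ≥0∞)) atTop (𝓝 ⊤)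

/-- The Fenchel-Legendre transform `Φ*(y) = sup_{x ≥ 0} (x y - Φ(x))`, with extended real values. -/
def fenchelE (Φ : ℝ≥0 → ℝ≥0∞) (y : ℝ) : EReal :=
  ⨆ x : ℝ≥0, (((x : ℝ) * y : ℝ) : EReal) - (Φ x : EReal)

/-- `Φ*` as a real-valued function; for a divergence function nothing is lost, see
`IsDivergenceFunction.coe_fenchel`. -/
def fenchel (Φ : ℝ≥0 → ℝ≥0∞) (y : ℝ) : ℝ := (fenchelE Φ y).toReal

theorem IsDivergenceFunction.coe_fenchel {Φ : ℝ≥0 → ℝ≥0∞} (hΦ : IsDivergenceFunction Φ) (y : ℝ) :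
    ((fenchel Φ y : ℝ) : EReal) = fenchelE Φ y := by
  refine EReal.coe_toReal ?_ ?_
  · have h := hΦ.growth.eventually (lt_mem_nhds (b := (⊤ : ℝ≥0∞)) (a := ENNReal.ofReal |y|)
      ENNReal.ofReal_lt_top)
    obtain ⟨N, hN⟩ := eventually_atTop.1 h
    refine ne_top_of_le_ne_top (EReal.coe_ne_top ((N : ℝ) * |y|)) (iSup_le fun x => ?_)
    rcases le_total x N with hx | hx
    · refine (EReal.sub_le_sub le_rfl (EReal.coe_ennreal_nonneg (Φ x))).trans ?_
      rw [sub_zero]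
      refine EReal.coe_le_coe_iff.2 ?_
      have h1 : (x : ℝ) ≤ N := by exact_mod_cast hx
      exact (mul_le_mul_of_nonneg_left (le_abs_self y) x.2).trans
        (mul_le_mul_of_nonneg_right h1 (abs_nonneg y))
    · have h1 : ENNReal.ofReal |y| * (x : ℝ≥0∞) ≤ Φ x :=
        ENNReal.mul_le_of_le_div (hN x hx).le
      have h2 : (((x : ℝ) * y : ℝ) : EReal) ≤ (Φ x : EReal) := by
        refine le_trans ?_ (EReal.coe_ennreal_le_coe_ennreal_iff.2 h1)
        rw [EReal.coe_ennreal_mul, EReal.coe_ennreal_ofReal, max_eq_left (abs_nonneg y),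
          show ((x : ℝ≥0∞) : EReal) = ((x : ℝ) : EReal) from rfl, ← EReal.coe_mul,
          EReal.coe_le_coe_iff, mul_comm |y|]
        exact mul_le_mul_of_nonneg_left (le_abs_self y) x.2
      refine le_trans (EReal.sub_nonpos.2 h2) ?_
      exact_mod_cast mul_nonneg N.2 (abs_nonneg y)
  · have h0 : (((0 : ℝ≥0) : ℝ) * y : ℝ) - (Φ 0 : EReal) ≤ fenchelE Φ y :=
      le_iSup (fun x : ℝ≥0 => (((x : ℝ) * y : ℝ) : EReal) - (Φ x : EReal)) 0
    refine ne_bot_of_le_ne_bot ?_ h0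
    lift Φ 0 to ℝ≥0 using hΦ.zero_lt_top.ne with c
    exact EReal.coe_ne_bot ((((0 : ℝ≥0) : ℝ) * y : ℝ) - (c : ℝ))

/-- `P` is atomless: every event of positive probability has a subevent of strictly smaller
positive probability. -/
def IsAtomless {Ω : Type*} [MeasurableSpace Ω] (P : Measure Ω) : Prop :=
  ∀ s, MeasurableSet s → 0 < P s → ∃ t ⊆ s, MeasurableSet t ∧ 0 < P t ∧ P t < P s

/-- The Orlicz heart of `Φ*`: random variables `X` with `E[Φ*(c|X|)] < ∞` for all `c > 0`.
(`Φ* ≥ 0` on `[0,∞[`, so the extended integral expresses the expectation.) -/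
def orliczHeart {Ω : Type*} [MeasurableSpace Ω] (Φ : ℝ≥0 → ℝ≥0∞) (P : Measure Ω) :
    Set (Ω → ℝ) :=
  {X | AEMeasurable X P ∧ ∀ c : ℝ, 0 < c → ∫⁻ ω, ENNReal.ofReal (fenchel Φ (c * |X ω|)) ∂P < ⊤}

/-- The divergence `E[Φ(dQ/dP)]`. -/
def divergence {Ω : Type*} [MeasurableSpace Ω] (Φ : ℝ≥0 → ℝ≥0∞) (P Q : Measure Ω) : ℝ≥0∞ :=
  ∫⁻ ω, Φ (Q.rnDeriv P ω).toNNReal ∂P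

/-- The set `𝒫_Φ` of probability measures `Q ≪ P` such that `Φ(dQ/dP)` is `P`-integrable. -/
def divergenceSet {Ω : Type*} [MeasurableSpace Ω] (Φ : ℝ≥0 → ℝ≥0∞) (P : Measure Ω) :
    Set (Measure Ω) :=
  {Q | IsProbabilityMeasure Q ∧ Q ≪ P ∧ divergence Φ P Q < ⊤}

/-- The divergence risk measure `ρ^Φ(X) = sup_{Q ∈ 𝒫_Φ} (E_Q[X] - E[Φ(dQ/dP)])`
for `X` in the Orlicz heart. -/
def divergenceRisk {Ω : Type*} [MeasurableSpace Ω] (Φ : ℝ≥0 → ℝ≥0∞) (P : Measure Ω)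
    (X : Ω → ℝ) : EReal :=
  ⨆ Q ∈ divergenceSet Φ P, ((∫ ω, X ω ∂Q : ℝ) : EReal) - (divergence Φ P Q : EReal)

/-- The distribution function of a random variable. -/
def distrFun {Ω : Type*} [MeasurableSpace Ω] (P : Measure Ω) (X : Ω → ℝ) (t : ℝ) : ℝ :=
  P.real {ω | X ω ≤ t}

open Classical in
/-- The functional `ℛ_{ρ^Φ}` on distribution functions of members of the Orlicz heart: its value
at `F` is `ρ^Φ(X)` for any `X` in the heart with distribution function `F` (`ρ^Φ` is
law-invariant). Outside its domain it gets the irrelevant value `⊤`. -/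
def riskFunctional {Ω : Type*} [MeasurableSpace Ω] (Φ : ℝ≥0 → ℝ≥0∞) (P : Measure Ω)
    (F : ℝ → ℝ) : EReal :=
  if h : ∃ X ∈ orliczHeart Φ P, distrFun P X = F then divergenceRisk Φ P h.choose else ⊤

/-- The left-continuous quantile function `F^←(u) = inf {t | u ≤ F(t)}`, `0 < u < 1`. -/
def quantile (F : ℝ → ℝ) (u : ℝ) : ℝ := sInf {t | u ≤ F t}

/-- The function of certainty equivalents `x ↦ ∫₀¹ Φ*(F^←(u) + x) du - x`. -/
def certaintyEquivalent (Φ : ℝ≥0 → ℝ≥0∞) (F : ℝ → ℝ) (x : ℝ) : ℝ :=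
  (∫ u in Set.Ioo (0 : ℝ) 1, fenchel Φ (quantile F u + x)) - x

/-- The set `M_F` of solutions of the minimization of `∫₀¹ Φ*(F^←(u) + x) du - x` over `x ∈ ℝ`. -/
def minimizerSet (Φ : ℝ≥0 → ℝ≥0∞) (F : ℝ → ℝ) : Set ℝ :=
  {x | ∀ y, certaintyEquivalent Φ F x ≤ certaintyEquivalent Φ F y}

/-- The empirical distribution function of `g(Z₁), …, g(Zₙ)` at `t`; the sample is
indexed from `0`. -/
def empiricalDistrFun {E : Type*} (n : ℕ) (g : E → ℝ) (z : ℕ → E) (t : ℝ) : ℝ :=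
  (1 / (n : ℝ)) * ∑ j ∈ Finset.range n, Set.indicator (Set.Iic t) (fun _ => (1 : ℝ)) (g (z j))

/-- The optimal value of the true program. -/
def trueValue {Ω : Type*} [MeasurableSpace Ω] {m d : ℕ} (Φ : ℝ≥0 → ℝ≥0∞) (P : Measure Ω)
    (Θ : Set (EuclideanSpace ℝ (Fin m))) (G : Θ → EuclideanSpace ℝ (Fin d) → ℝ)
    (Z : Ω → EuclideanSpace ℝ (Fin d)) : EReal :=
  ⨅ θ : Θ, riskFunctional Φ P (distrFun P (fun ω => G θ (Z ω)))

/-- The optimal value of the sample average approximation with the sample `z₁, …, zₙ`. -/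
def saaValue {Ω : Type*} [MeasurableSpace Ω] {m d : ℕ} (Φ : ℝ≥0 → ℝ≥0∞) (P : Measure Ω)
    (Θ : Set (EuclideanSpace ℝ (Fin m))) (G : Θ → EuclideanSpace ℝ (Fin d) → ℝ)
    (n : ℕ) (z : ℕ → EuclideanSpace ℝ (Fin d)) : EReal :=
  ⨅ θ : Θ, riskFunctional Φ P (empiricalDistrFun n (G θ) z)

/-- The set of minimizers of the true program. -/
def argminRisk {Ω : Type*} [MeasurableSpace Ω] {m d : ℕ} (Φ : ℝ≥0 → ℝ≥0∞) (P : Measure Ω)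
    (Θ : Set (EuclideanSpace ℝ (Fin m))) (G : Θ → EuclideanSpace ℝ (Fin d) → ℝ)
    (Z : Ω → EuclideanSpace ℝ (Fin d)) : Set Θ :=
  {θ | ∀ θ' : Θ, riskFunctional Φ P (distrFun P (fun ω => G θ (Z ω))) ≤
    riskFunctional Φ P (distrFun P (fun ω => G θ' (Z ω)))}

end

/-! ### Atomless probability spaces -/

section Atomless

variable {Ω : Type*} [MeasurableSpace Ω] {P : Measure Ω}

/-! The engine is the duality `ρ^Φ(X) = min_x (E[Φ*(X + x)] - x)`. Integrating Young's inequality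
against a density gives `≤`. For equality take an optimal `x`: comparing its cost with that of
nearby shifts shows that the left and right limits of a monotone subgradient selection of `Φ*` along
`X + x` have means at most and at least `1`. Some convex combination of them is therefore a density,
it still gives equality in Young's inequality, and it attains the supremum.

The true program and its sample versions thereby become joint minimizations over `(θ, x)` of the
mean of `h(θ, x, z) = Φ*(G(θ, z) + x) - x`, under the law of `Z` and under the empirical measure.
Atomlessness enters through Sierpiński's theorem, which realizes each empirical law on `Ω` and so
puts it in the domain of the risk functional. The integrand is lower semicontinuous in `(θ, x)`
because `Φ*` is continuous and nondecreasing. Its mean is coercive in `x`: `Φ* ≥ -Φ(0)` controls `x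
→ -∞`, and `Φ(x₀) < ∞` with `x₀ > 1` controls `x → ∞`, uniformly in `θ` since `ξ₁` bounds the means
of `G(θ, ·)` from below. Hence sublevel sets are compact and minimizers exist.

For convergence, the upper bound is the strong law at one optimal pair. For the lower bound,
coercivity confines `x` to a compact interval, and finitely many integrable local minorants of `h`,
each obeying the strong law, cover what remains (`exists_local_minorant`).

Both the minorants and the optimal values are infima over uncountable sets. Their Borel
measurability, with no completion of `P`, comes from projecting Borel sets with closed sections
along a compact set, via Novikov separation and the Kunugui–Novikov theorem. -/

theorem IsAtomless.exists_subset_half [IsFiniteMeasure P] (hP : IsAtomless P) {s : Set Ω}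
    (hs : MeasurableSet s) (hpos : 0 < P.real s) :
    ∃ t ⊆ s, MeasurableSet t ∧ 0 < P.real t ∧ P.real t ≤ P.real s / 2 := by
  obtain ⟨t, hts, ht, h0, hlt⟩ := hP s hs (ENNReal.toReal_pos_iff.1 hpos).1
  have h0' : 0 < P.real t := ENNReal.toReal_pos h0.ne' (measure_ne_top P t)
  have hlt' : P.real t < P.real s :=
    (ENNReal.toReal_lt_toReal (measure_ne_top P t) (measure_ne_top P s)).2 hlt
  have hd : P.real (s \ t) = P.real s - P.real t := measureReal_sdiff hts ht
  rcases le_total (P.real t) (P.real s / 2) with h | h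
  · exact ⟨t, hts, ht, h0', h⟩
  · exact ⟨s \ t, Set.sdiff_subset, hs.diff ht, by linarith, by linarith⟩

theorem IsAtomless.exists_subset_lt [IsFiniteMeasure P] (hP : IsAtomless P) {s : Set Ω}
    (hs : MeasurableSet s) (hpos : 0 < P.real s) {ε : ℝ} (hε : 0 < ε) :
    ∃ t ⊆ s, MeasurableSet t ∧ 0 < P.real t ∧ P.real t < ε := by
  have key : ∀ k : ℕ, ∃ t ⊆ s, MeasurableSet t ∧ 0 < P.real t ∧
      P.real t ≤ P.real s * (1 / 2) ^ k := by
    intro k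
    induction k with
    | zero => exact ⟨s, subset_rfl, hs, hpos, by simp⟩
    | succ k ih =>
      obtain ⟨t, hts, ht, h0, hle⟩ := ih
      obtain ⟨u, hut, hu, hu0, hule⟩ := hP.exists_subset_half ht h0
      refine ⟨u, hut.trans hts, hu, hu0, hule.trans ?_⟩
      rw [pow_succ]
      linarith
  obtain ⟨k, hk⟩ := exists_pow_lt_of_lt_one (div_pos hε hpos) (by norm_num : (1 / 2 : ℝ) < 1)
  obtain ⟨t, hts, ht, h0, hle⟩ := key k
  refine ⟨t, hts, ht, h0, hle.trans_lt ?_⟩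
  rwa [lt_div_iff₀' hpos] at hk

/-- **Sierpiński's theorem**: a finite atomless measure attains all intermediate values. -/
theorem IsAtomless.exists_subset_measureReal_eq [IsFiniteMeasure P] (hP : IsAtomless P)
    {s : Set Ω} (hs : MeasurableSet s) {c : ℝ} (hc : 0 ≤ c) (hcs : c ≤ P.real s) :
    ∃ t ⊆ s, MeasurableSet t ∧ P.real t = c := by
  let A := {t : Set Ω // t ⊆ s ∧ MeasurableSet t ∧ P.real t ≤ c}
  -- Greedy extension: `t'` realizes at least half of the supremal gain in measure available above
  -- `t`.
  have step : ∀ t : A, ∃ t' : A, t.1 ⊆ t'.1 ∧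
      ∀ u : A, t.1 ⊆ u.1 → P.real t.1 + P.real u.1 ≤ 2 * P.real t'.1 := by
    intro t
    let S : Set ℝ := {r | ∃ u : A, t.1 ⊆ u.1 ∧ P.real u.1 = r}
    have hS : BddAbove S := ⟨c, by rintro r ⟨u, -, rfl⟩; exact u.2.2.2⟩
    rcases le_or_gt (sSup S) (P.real t.1) with h | h
    · refine ⟨t, subset_rfl, fun u hu => ?_⟩
      have := le_csSup hS ⟨u, hu, rfl⟩
      linarith
    · have hlt : (P.real t.1 + sSup S) / 2 < sSup S := by linarith
      obtain ⟨r, ⟨u, hu, rfl⟩, hr⟩ := exists_lt_of_lt_csSup (s := S) ⟨_, t, subset_rfl, rfl⟩ hlt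
      refine ⟨u, hu, fun w hw => ?_⟩
      have := le_csSup hS ⟨w, hw, rfl⟩
      linarith
  choose F hF hF' using step
  let t0 : A := ⟨∅, Set.empty_subset s, MeasurableSet.empty, by simpa using hc⟩
  let t : ℕ → A := fun k => F^[k] t0
  have ht : ∀ k, t (k + 1) = F (t k) := fun k => Function.iterate_succ_apply' F k t0
  have hmono : Monotone fun k => (t k).1 :=
    monotone_nat_of_le_succ fun k => by rw [ht]; exact hF _
  set T : Set Ω := ⋃ k, (t k).1 with hTdef
  have hTm : MeasurableSet T := MeasurableSet.iUnion fun k => (t k).2.2.1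
  have hTs : T ⊆ s := Set.iUnion_subset fun k => (t k).2.1
  have hlim : Tendsto (fun k => P.real (t k).1) atTop (𝓝 (P.real T)) :=
    (ENNReal.tendsto_toReal (measure_ne_top P T)).comp (tendsto_measure_iUnion_atTop hmono)
  have hTc : P.real T ≤ c := le_of_tendsto' hlim fun k => (t k).2.2.2
  refine ⟨T, hTs, hTm, hTc.antisymm (not_lt.1 fun hlt => ?_)⟩
  have hd : P.real (s \ T) = P.real s - P.real T := measureReal_sdiff hTs hTm
  -- If `T` falls short of `c`, a piece `u` small enough to keep `T ∪ u` admissible was available at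
  -- every stage. The greedy inequality then gives `P (T ∪ u) ≤ P T` in the limit.
  obtain ⟨u, hus, hu, hu0, hult⟩ := hP.exists_subset_lt (hs.diff hTm) (by linarith)
    (sub_pos.2 hlt)
  have hdisj : Disjoint T u := (Set.disjoint_sdiff_right (s := T) (t := s)).mono_right hus
  have hun : P.real (T ∪ u) = P.real T + P.real u := measureReal_union hdisj hu
  let w : A := ⟨T ∪ u, Set.union_subset hTs (hus.trans Set.sdiff_subset), hTm.union hu, by
    rw [hun]; linarith⟩
  have hk : ∀ k, P.real (t k).1 + P.real w.1 ≤ 2 * P.real (t (k + 1)).1 := fun k => by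
    rw [ht]
    exact hF' _ _ ((Set.subset_iUnion (fun k => (t k).1) k).trans Set.subset_union_left)
  have := le_of_tendsto_of_tendsto' (hlim.add_const (P.real w.1))
    ((hlim.comp (tendsto_add_atTop_nat 1)).const_mul 2) hk
  have hw : P.real w.1 = P.real T + P.real u := hun
  linarith

/-- Sets are carved off one at a time: after `k < n` of them the complement still has measure at
least `1 / n`. Keeping the later sets empty makes disjointness of the whole sequence inductive. -/
theorem IsAtomless.exists_disjoint_sets [IsProbabilityMeasure P] (hP : IsAtomless P) {n : ℕ}
    {k : ℕ} (hk : k ≤ n) :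
    ∃ A : ℕ → Set Ω, (∀ j, MeasurableSet (A j)) ∧ (∀ j < k, P.real (A j) = 1 / n) ∧
      (∀ j, k ≤ j → A j = ∅) ∧ Pairwise (Function.onFun Disjoint A) := by
  induction k with
  | zero =>
    exact ⟨fun _ => ∅, fun _ => MeasurableSet.empty, fun j hj => absurd hj (Nat.not_lt_zero j),
      fun _ _ => rfl, fun _ _ _ => disjoint_bot_left⟩
  | succ k ih =>
    obtain ⟨A, hAm, hA, hA0, hAd⟩ := ih (Nat.le_of_succ_le hk)
    have hn : (0 : ℝ) < n := by exact_mod_cast (Nat.succ_pos k).trans_le hk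
    set U : Set Ω := ⋃ j ∈ Finset.range k, A j with hU
    have hUm : MeasurableSet U := Finset.measurableSet_biUnion _ fun j _ => hAm j
    have hUr : P.real U = k / n := by
      rw [hU, measureReal_biUnion_finset (fun i _ j _ hij => hAd hij) fun j _ => hAm j,
        Finset.sum_congr rfl fun j hj => hA j (Finset.mem_range.1 hj)]
      simp [div_eq_mul_inv]
    have hcompl : 1 / (n : ℝ) ≤ P.real Uᶜ := by
      rw [probReal_compl_eq_one_sub hUm, hUr, div_le_iff₀ hn, sub_mul, div_mul_cancel₀ _ hn.ne']
      have : (k : ℝ) + 1 ≤ n := by exact_mod_cast hk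
      linarith
    obtain ⟨t, htU, htm, ht⟩ := hP.exists_subset_measureReal_eq hUm.compl (by positivity) hcompl
    have hdt : ∀ j, j ≠ k → Disjoint (A j) t := by
      intro j hj
      rcases lt_or_gt_of_ne hj with h | h
      · refine Disjoint.mono_right htU ?_
        exact disjoint_compl_right.mono_left
          (Set.subset_biUnion_of_mem (u := A) (Finset.mem_coe.2 (Finset.mem_range.2 h)))
      · rw [hA0 j h.le]
        exact disjoint_bot_left
    refine ⟨Function.update A k t, fun j => ?_, fun j hj => ?_, fun j hj => ?_, fun i j hij => ?_⟩
    · rcases eq_or_ne j k with rfl | h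
      · simpa using htm
      · simpa [h] using hAm j
    · rcases eq_or_ne j k with rfl | h
      · simpa using ht
      · simpa [h] using hA j (by omega)
    · rw [Function.update_of_ne (by omega)]
      exact hA0 j (by omega)
    · rcases eq_or_ne i k with rfl | hi
      · simpa [Function.onFun, hij.symm] using (hdt j hij.symm).symm
      · rcases eq_or_ne j k with rfl | hj
        · simpa [Function.onFun, hi] using hdt i hi
        · simpa [Function.onFun, hi, hj] using hAd hij

/-- On an atomless probability space every empirical measure is the law of a random variable. -/
theorem IsAtomless.exists_map_eq_sum_dirac [IsProbabilityMeasure P] (hP : IsAtomless P) {n : ℕ}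
    (hn : 1 ≤ n) (y : ℕ → ℝ) :
    ∃ X : Ω → ℝ, Measurable X ∧
      P.map X = ∑ j ∈ Finset.range n, (n : ℝ≥0∞)⁻¹ • Measure.dirac (y j) := by
  obtain ⟨A, hAm, hA, -, hAd⟩ := hP.exists_disjoint_sets le_rfl (n := n)
  have hn0 : (n : ℝ) ≠ 0 := by positivity
  have hA' : ∀ j < n, P (A j) = (n : ℝ≥0∞)⁻¹ := by
    intro j hj
    rw [← ENNReal.ofReal_toReal (measure_ne_top P (A j))]
    change ENNReal.ofReal (P.real (A j)) = _
    rw [hA j hj, one_div, ENNReal.ofReal_inv_of_pos (by positivity), ENNReal.ofReal_natCast]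
  let X : Ω → ℝ := fun ω => ∑ j ∈ Finset.range n, (A j).indicator (fun _ => y j) ω
  have hX : Measurable X :=
    Finset.measurable_fun_sum _ fun j _ => measurable_const.indicator (hAm j)
  have hXA : ∀ j < n, ∀ ω ∈ A j, X ω = y j := by
    intro j hj ω hω
    change ∑ i ∈ Finset.range n, _ = _
    rw [Finset.sum_eq_single_of_mem j (Finset.mem_range.2 hj)]
    · simp [hω]
    · intro i _ hij
      exact Set.indicator_of_notMem (Set.disjoint_right.1 (hAd hij) hω) _
  refine ⟨X, hX, ?_⟩
  set U : Set Ω := ⋃ j ∈ Finset.range n, A j with hU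
  have hUm : MeasurableSet U := Finset.measurableSet_biUnion _ fun j _ => hAm j
  have hU1 : P U = 1 := by
    rw [hU, measure_biUnion_finset (fun i _ j _ hij => hAd hij) fun j _ => hAm j,
      Finset.sum_congr rfl fun j hj => hA' j (Finset.mem_range.1 hj)]
    simp only [Finset.sum_const, Finset.card_range, nsmul_eq_mul]
    exact ENNReal.mul_inv_cancel (by simpa using hn0) (ENNReal.natCast_ne_top n)
  ext B hB
  rw [Measure.map_apply hX hB, Measure.finsetSum_apply]
  -- The cells exhaust `Ω` up to a null set, so the default value `0` of `X` outside them does not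
  -- affect the law.
  have h1 : P (X ⁻¹' B) = P (⋃ j ∈ Finset.range n, A j ∩ X ⁻¹' B) := by
    rw [← Set.iUnion₂_inter]
    refine (measure_inter_conull' ?_).symm.trans (by rw [Set.inter_comm])
    refine measure_mono_null (Set.sdiff_subset_compl _ _) ?_
    exact (prob_compl_eq_zero_iff hUm).2 hU1
  rw [h1, measure_biUnion_finset
    (fun i _ j _ hij => (hAd hij).mono Set.inter_subset_left Set.inter_subset_left)
    fun j _ => (hAm j).inter (hX hB)]
  refine Finset.sum_congr rfl fun j hj => ?_
  have hj' := Finset.mem_range.1 hj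
  rw [Measure.smul_apply, Measure.dirac_apply' _ hB, smul_eq_mul]
  by_cases hy : y j ∈ B
  · have : A j ∩ X ⁻¹' B = A j :=
      Set.inter_eq_left.2 fun ω hω => by simpa [hXA j hj' ω hω] using hy
    simp [this, hy, hA' j hj']
  · have : A j ∩ X ⁻¹' B = ∅ := by
      ext ω
      simp only [Set.mem_inter_iff, Set.mem_preimage, Set.mem_empty_iff_false, iff_false, not_and]
      intro hω
      rwa [hXA j hj' ω hω]
    simp [this, hy]

end Atomless

/-! ### Separation of sequences of analytic sets and Borel sets with closed sections -/

section Novikov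

variable {α : Type*}

/-- A sequence of sets is measurably separable if it is dominated by a sequence of measurable sets
with empty intersection. -/
def SeqMeasurablySeparable [MeasurableSpace α] (s : ℕ → Set α) : Prop :=
  ∃ u : ℕ → Set α, (∀ n, s n ⊆ u n) ∧ (∀ n, MeasurableSet (u n)) ∧ ⋂ n, u n = ∅

/-- Take unions of the separating sets at index `m` and intersections elsewhere. Used
contrapositively: a nonseparable sequence stays nonseparable when one member is replaced by a
suitable piece of a countable cover. -/
theorem SeqMeasurablySeparable.of_update_iUnion [MeasurableSpace α] {s : ℕ → Set α} {m : ℕ}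
    {t : ℕ → Set α} (hst : s m ⊆ ⋃ j, t j)
    (h : ∀ j, SeqMeasurablySeparable (Function.update s m (t j))) : SeqMeasurablySeparable s := by
  choose u hsu hum hu using h
  refine ⟨fun n => if n = m then ⋃ j, u j m else ⋂ j, u j n, fun n => ?_, fun n => ?_, ?_⟩
  · by_cases hn : n = m
    · subst hn
      simp only [if_true]
      refine hst.trans (Set.iUnion_mono fun j => ?_)
      simpa using hsu j n
    · simp only [hn, if_false]
      refine Set.subset_iInter fun j => ?_
      simpa [hn] using hsu j n
  · by_cases hn : n = m
    · simp only [hn, if_true]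
      exact MeasurableSet.iUnion fun j => hum j m
    · simp only [hn, if_false]
      exact MeasurableSet.iInter fun j => hum j n
  · refine Set.eq_empty_of_forall_notMem fun x hx => ?_
    rw [Set.mem_iInter] at hx
    have hm := hx m
    simp only [if_true, Set.mem_iUnion] at hm
    obtain ⟨j, hj⟩ := hm
    have : x ∈ ⋂ n, u j n := by
      refine Set.mem_iInter.2 fun n => ?_
      by_cases hn : n = m
      · exact hn ▸ hj
      · have := hx n
        simp only [hn, if_false, Set.mem_iInter] at this
        exact this j
    rw [hu j] at this
    exact this

/-- The points of the Baire space whose coordinates `i` with `Nat.pair n i < k` are those of the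
`n`-th component of `w`. -/
def pairCylinder (w : ℕ → ℕ) (k n : ℕ) : Set (ℕ → ℕ) :=
  {x | ∀ i, Nat.pair n i < k → x i = w (Nat.pair n i)}

theorem pairCylinder_congr {w w' : ℕ → ℕ} {k : ℕ} (h : ∀ i < k, w i = w' i) (n : ℕ) :
    pairCylinder w k n = pairCylinder w' k n := by
  ext x
  refine forall_congr' fun i => forall_congr' fun hi => ?_
  rw [h _ hi]

/-- A single `w : ℕ → ℕ` encodes one Baire point per index through `Nat.pair`. Fixing its
coordinates one by one while preserving nonseparability produces points `x n`. If two values `f n (x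
n)` differed, disjoint open neighbourhoods would separate the images of small cylinders. So all
values agree, contradicting the empty intersection. -/
theorem seqMeasurablySeparable_range [TopologicalSpace α] [T2Space α] [MeasurableSpace α]
    [OpensMeasurableSpace α] {f : ℕ → (ℕ → ℕ) → α} (hf : ∀ n, Continuous (f n))
    (h : ⋂ n, Set.range (f n) = ∅) : SeqMeasurablySeparable fun n => Set.range (f n) := by
  by_contra hsep
  let B : (ℕ → ℕ) → ℕ → ℕ → Set α := fun w k n => f n '' pairCylinder w k n
  have step : ∀ k (w : ℕ → ℕ), ¬ SeqMeasurablySeparable (B w k) →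
      ∃ j, ¬ SeqMeasurablySeparable (B (Function.update w k j) (k + 1)) := by
    intro k w
    contrapose!
    intro H
    refine SeqMeasurablySeparable.of_update_iUnion (m := k.unpair.1)
      (t := fun j => B (Function.update w k j) (k + 1) k.unpair.1) ?_ fun j => ?_
    · rintro _ ⟨x, hx, rfl⟩
      refine Set.mem_iUnion.2 ⟨x k.unpair.2, x, fun i hi => ?_, rfl⟩
      rcases Nat.lt_succ_iff_lt_or_eq.1 hi with hlt | heq
      · rw [Function.update_of_ne hlt.ne]
        exact hx i hlt
      · have : i = k.unpair.2 := by rw [← heq, Nat.unpair_pair]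
        rw [heq, Function.update_self, this]
    -- Coordinate `k` belongs to component `k.unpair.1` alone, so the other images are unchanged.
    · convert H j using 1
      ext1 n
      by_cases hn : n = k.unpair.1
      · subst hn
        simp
      · rw [Function.update_of_ne hn]
        refine congrArg (f n '' ·) (Set.ext fun x => forall_congr' fun i => ?_)
        have hne : Nat.pair n i ≠ k := fun he => hn (by rw [← he, Nat.unpair_pair])
        rw [Function.update_of_ne hne]
        refine imp_congr_left ?_
        omega
  choose J hJ using step
  let A := {p : ℕ × (ℕ → ℕ) // ¬ SeqMeasurablySeparable (B p.2 p.1)}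
  let F : A → A := fun p => ⟨(p.1.1 + 1, Function.update p.1.2 p.1.1 (J _ _ p.2)), hJ _ _ p.2⟩
  let p0 : A := ⟨(0, fun _ => 0), by simpa [B, pairCylinder] using hsep⟩
  let p : ℕ → A := fun k => F^[k] p0
  have hp : ∀ k, p (k + 1) = F (p k) := fun k => Function.iterate_succ_apply' F k p0
  have hp1 : ∀ k, (p k).1.1 = k := by
    intro k
    induction k with
    | zero => rfl
    | succ k ih => rw [hp]; exact congrArg (· + 1) ih
  -- Coordinate `i` is chosen at stage `i` and never changed afterwards, which makes the diagonal
  -- limit `w` well behaved.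
  have hstat : ∀ i k, i + 1 ≤ k → (p k).1.2 i = (p (i + 1)).1.2 i := by
    intro i
    refine Nat.le_induction rfl fun k hk ih => ?_
    rw [hp, ← ih]
    exact Function.update_of_ne (by rw [hp1]; omega) _ _
  let w : ℕ → ℕ := fun i => (p (i + 1)).1.2 i
  have hw : ∀ k, ¬ SeqMeasurablySeparable (B w k) := by
    intro k
    have hk := (p k).2
    rw [hp1] at hk
    convert hk using 2
    ext1 n
    exact congrArg (f n '' ·) (pairCylinder_congr (fun i hi => (hstat i k hi).symm) n)
  let x : ℕ → ℕ → ℕ := fun n i => w (Nat.pair n i)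
  have hsmall : ∀ n, ∀ V : Set α, IsOpen V → f n (x n) ∈ V → ∃ k, ∀ l ≥ k, B w l n ⊆ V := by
    intro n V hV hxV
    have hmem : f n ⁻¹' V ∈ 𝓝 (x n) := (hf n).continuousAt.preimage_mem_nhds (hV.mem_nhds hxV)
    obtain ⟨_, ⟨y, r, rfl⟩, hy, hyV⟩ :=
      (PiNat.isTopologicalBasis_cylinders (fun _ : ℕ => ℕ)).mem_nhds_iff.1 hmem
    refine ⟨(Finset.range r).sup (fun i => Nat.pair n i + 1), fun l hl => ?_⟩
    rintro _ ⟨z, hz, rfl⟩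
    refine hyV fun i hi => ?_
    have : Nat.pair n i + 1 ≤ l :=
      (Finset.le_sup (f := fun i => Nat.pair n i + 1) (Finset.mem_range.2 hi)).trans hl
    rw [hz i this, ← hy i hi]
  have heq : ∀ n, f n (x n) = f 0 (x 0) := by
    intro n
    by_contra hne
    have hn0 : n ≠ 0 := by rintro rfl; exact hne rfl
    obtain ⟨u, v, hu, hv, hxu, hxv, huv⟩ := t2_separation hne
    obtain ⟨k₁, hk₁⟩ := hsmall n u hu hxu
    obtain ⟨k₂, hk₂⟩ := hsmall 0 v hv hxv
    refine hw (max k₁ k₂) ⟨fun i => if i = n then u else if i = 0 then v else Set.univ,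
      fun i => ?_, fun i => ?_, ?_⟩
    · by_cases hi : i = n
      · subst hi
        simpa using hk₁ _ (le_max_left _ _)
      · by_cases hi0 : i = 0
        · subst hi0
          simpa [hi] using hk₂ _ (le_max_right _ _)
        · simp [hi, hi0]
    · dsimp only
      split_ifs
      exacts [hu.measurableSet, hv.measurableSet, MeasurableSet.univ]
    · refine Set.eq_empty_of_forall_notMem fun a ha => ?_
      rw [Set.mem_iInter] at ha
      have h1 := ha n
      have h2 := ha 0
      simp only [if_true] at h1
      simp only [hn0.symm, if_false, if_true] at h2
      exact Set.disjoint_left.1 huv h1 h2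
  have : f 0 (x 0) ∈ ⋂ n, Set.range (f n) := Set.mem_iInter.2 fun n => ⟨x n, heq n⟩
  rw [h] at this
  exact this

/-- **Novikov's separation theorem**: a sequence of analytic sets with empty intersection is
dominated by a sequence of Borel sets with empty intersection. -/
theorem seqMeasurablySeparable_of_analyticSet [TopologicalSpace α] [T2Space α] [MeasurableSpace α]
    [OpensMeasurableSpace α] {s : ℕ → Set α} (hs : ∀ n, AnalyticSet (s n))
    (h : ⋂ n, s n = ∅) : SeqMeasurablySeparable s := by
  by_cases hne : ∃ n, s n = ∅
  · obtain ⟨n, hn⟩ := hne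
    refine ⟨Function.update (fun _ => Set.univ) n ∅, fun i => ?_, fun i => ?_, ?_⟩
    · rcases eq_or_ne i n with rfl | hi
      · simp [hn]
      · simp [hi]
    · rcases eq_or_ne i n with rfl | hi
      · simp
      · simp [hi]
    · exact Set.eq_empty_of_subset_empty (Set.iInter_subset_of_subset n (by simp))
  · have : ∀ n, ∃ f : (ℕ → ℕ) → α, Continuous f ∧ Set.range f = s n := by
      intro n
      have := hs n
      rw [AnalyticSet] at this
      exact this.resolve_left fun h => hne ⟨n, h⟩
    choose f hf hfs using this
    have key := seqMeasurablySeparable_range hf (by simpa [hfs] using h)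
    simpa [hfs] using key

variable {X K : Type*} [TopologicalSpace X] [PolishSpace X] [MeasurableSpace X] [BorelSpace X]
  [TopologicalSpace K] [PolishSpace K] [MeasurableSpace K] [BorelSpace K]

/-- The **Kunugui–Novikov theorem**: a Borel set with open sections is a countable union of
products of Borel sets with basic open sets. -/
theorem exists_eq_iUnion_prod_of_isOpen_sections {C : Set (X × K)} (hC : MeasurableSet C)
    (hopen : ∀ x, IsOpen {k | (x, k) ∈ C}) :
    ∃ (B : ℕ → Set X) (V : ℕ → Set K), (∀ n, MeasurableSet (B n)) ∧ (∀ n, IsOpen (V n)) ∧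
      C = ⋃ n, B n ×ˢ V n := by
  obtain ⟨V, hV⟩ := TopologicalSpace.exists_seq_basis K
  have hVo : ∀ n, IsOpen (V n) := fun n => hV.isOpen ⟨n, rfl⟩
  let S : ℕ → Set X := fun n => Prod.fst '' (Cᶜ ∩ Prod.snd ⁻¹' V n)
  have hS : ∀ n, AnalyticSet (S n) := fun n =>
    (hC.compl.inter (measurable_snd (hVo n).measurableSet)).analyticSet_image measurable_fst
  have hSV : ∀ n x, x ∉ S n → ∀ k ∈ V n, (x, k) ∈ C := by
    intro n x hx k hk
    by_contra hxk
    exact hx ⟨(x, k), ⟨hxk, hk⟩, rfl⟩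
  -- `E n` collects the points of `C` missed by the largest box over `V n` inside `C`, whose base
  -- `(S n)ᶜ` need not be Borel. Openness of the sections makes `⋂ n, E n` empty. Novikov's theorem
  -- then encloses each `E n` in a Borel `D n`, still with empty intersection, and Lusin separation
  -- of the projection of `C \ D n` from `S n` supplies the Borel base `B n`.
  let E : ℕ → Set (X × K) := fun n => C ∩ (Prod.fst ⁻¹' S n ∪ Prod.snd ⁻¹' (V n)ᶜ)
  have hE : ∀ n, AnalyticSet (E n) := fun n => by
    have h1 : AnalyticSet (Prod.fst ⁻¹' S n ∪ Prod.snd ⁻¹' (V n)ᶜ : Set (X × K)) := by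
      rw [Set.union_eq_iUnion]
      refine AnalyticSet.iUnion fun b => ?_
      cases b
      · exact (measurable_snd (hVo n).measurableSet.compl).analyticSet
      · exact (hS n).preimage continuous_fst
    change AnalyticSet (C ∩ _)
    rw [Set.inter_eq_iInter]
    refine AnalyticSet.iInter fun b => ?_
    cases b
    · exact h1
    · exact hC.analyticSet
  have hE0 : ⋂ n, E n = ∅ := by
    refine Set.eq_empty_of_forall_notMem ?_
    rintro ⟨x, k⟩ hxk
    rw [Set.mem_iInter] at hxk
    obtain ⟨_, ⟨n, rfl⟩, hkn, hsub⟩ := hV.mem_nhds_iff.1 ((hopen x).mem_nhds (hxk 0).1)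
    rcases (hxk n).2 with h | h
    · obtain ⟨⟨x', k'⟩, ⟨hC', hk'⟩, rfl⟩ := h
      exact hC' (hsub hk')
    · exact h hkn
  obtain ⟨D, hED, hD, hD0⟩ := seqMeasurablySeparable_of_analyticSet hE hE0
  have hsepar : ∀ n, MeasurablySeparable (Prod.fst '' (C \ D n)) (S n) := by
    intro n
    refine AnalyticSet.measurablySeparable
      ((hC.diff (hD n)).analyticSet_image measurable_fst) (hS n) ?_
    rw [Set.disjoint_left]
    rintro _ ⟨⟨x, k⟩, ⟨hxC, hxD⟩, rfl⟩ hxS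
    exact hxD (hED n ⟨hxC, Or.inl hxS⟩)
  choose B hCB hBS hB using hsepar
  refine ⟨B, V, hB, hVo, ?_⟩
  ext ⟨x, k⟩
  simp only [Set.mem_iUnion, Set.mem_prod]
  constructor
  · intro hx
    have : (x, k) ∉ ⋂ n, D n := by simp [hD0]
    rw [Set.mem_iInter, not_forall] at this
    obtain ⟨n, hn⟩ := this
    refine ⟨n, hCB n ⟨(x, k), ⟨hx, hn⟩, rfl⟩, ?_⟩
    by_contra hk
    exact hn (hED n ⟨hx, Or.inr hk⟩)
  · rintro ⟨n, hx, hk⟩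
    exact hSV n x (fun h => Set.disjoint_left.1 (hBS n) h hx) k hk

/-- The projection of a Borel set with compact sections is a Borel set. -/
theorem measurableSet_exists_mem_of_isClosed_sections {D : Set (X × K)} (hD : MeasurableSet D)
    (hclosed : ∀ x, IsClosed {k | (x, k) ∈ D}) {S : Set K} (hS : IsCompact S) :
    MeasurableSet {x | ∃ k ∈ S, (x, k) ∈ D} := by
  obtain ⟨B, V, hB, hV, hBV⟩ := exists_eq_iUnion_prod_of_isOpen_sections hD.compl
    fun x => (hclosed x).isOpen_compl
  -- By compactness, the section over `x` misses `S` iff finitely many `V n` with `x ∈ B n` cover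
  -- `S`, and there are only countably many finite index sets.
  have key : {x | ∃ k ∈ S, (x, k) ∈ D}ᶜ =
      ⋃ F : {F : Finset ℕ // S ⊆ ⋃ n ∈ F, V n}, ⋂ n ∈ F.1, B n := by
    ext x
    simp only [Set.mem_compl_iff, Set.mem_ofPred_eq, not_exists, not_and, Set.mem_iUnion,
      Set.mem_iInter]
    have hmem : ∀ k, (x, k) ∉ D ↔ ∃ n, x ∈ B n ∧ k ∈ V n := by
      intro k
      rw [← Set.mem_compl_iff, hBV]
      simp
    constructor
    · intro h
      have hcov : S ⊆ ⋃ n : {n // x ∈ B n}, V n.1 := by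
        intro k hk
        obtain ⟨n, hn, hkn⟩ := (hmem k).1 (h k hk)
        exact Set.mem_iUnion.2 ⟨⟨n, hn⟩, hkn⟩
      obtain ⟨t, ht⟩ := hS.elim_finite_subcover (fun n : {n // x ∈ B n} => V n.1) (fun n => hV n.1) hcov
      refine ⟨⟨t.image Subtype.val, fun k hk => ?_⟩, fun n hn => ?_⟩
      · obtain ⟨n, hn, hkn⟩ := Set.mem_iUnion₂.1 (ht hk)
        exact Set.mem_iUnion₂.2 ⟨n.1, Finset.mem_image_of_mem _ hn, hkn⟩
      · obtain ⟨m, -, rfl⟩ := Finset.mem_image.1 hn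
        exact m.2
    · rintro ⟨⟨F, hF⟩, hx⟩ k hk
      obtain ⟨n, hn, hkn⟩ := Set.mem_iUnion₂.1 (hF hk)
      exact (hmem k).2 ⟨n, hx n hn, hkn⟩
  rw [← MeasurableSet.compl_iff, key]
  exact MeasurableSet.iUnion fun F => Finset.measurableSet_biInter _ fun n _ => hB n

end Novikov

/-! ### The Fenchel-Legendre transform -/

section Fenchel

variable {Φ : ℝ≥0 → ℝ≥0∞}

namespace IsDivergenceFunction

theorem young (hΦ : IsDivergenceFunction Φ) {x : ℝ≥0} (hx : Φ x ≠ ⊤) (y : ℝ) :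
    (x : ℝ) * y ≤ (Φ x).toReal + fenchel Φ y := by
  have h : (((x : ℝ) * y : ℝ) : EReal) - (Φ x : EReal) ≤ fenchelE Φ y :=
    le_iSup (fun x : ℝ≥0 => (((x : ℝ) * y : ℝ) : EReal) - (Φ x : EReal)) x
  rw [← hΦ.coe_fenchel] at h
  lift Φ x to ℝ≥0 using hx with c
  have h' : (((x : ℝ) * y - (c : ℝ) : ℝ) : EReal) ≤ (fenchel Φ y : EReal) := h
  rw [EReal.coe_le_coe_iff] at h'
  simp only [ENNReal.coe_toReal]
  linarith

theorem exists_lt_sub (hΦ : IsDivergenceFunction Φ) {y c : ℝ} (hc : c < fenchel Φ y) :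
    ∃ x : ℝ≥0, Φ x ≠ ⊤ ∧ c < (x : ℝ) * y - (Φ x).toReal := by
  have h : (c : EReal) < fenchelE Φ y := by
    rw [← hΦ.coe_fenchel]
    exact_mod_cast hc
  obtain ⟨x, hx⟩ := lt_iSup_iff.1 h
  have hx' : Φ x ≠ ⊤ := by
    intro h
    rw [h] at hx
    simp at hx
  refine ⟨x, hx', ?_⟩
  lift Φ x to ℝ≥0 using hx' with b
  have h' : (c : EReal) < (((x : ℝ) * y - (b : ℝ) : ℝ) : EReal) := hx
  rw [EReal.coe_lt_coe_iff] at h'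
  simpa using h'

theorem le_ofReal_of_tendsto (hΦ : IsDivergenceFunction Φ) {x : ℕ → ℝ≥0} {x' : ℝ≥0} {c : ℕ → ℝ}
    {c' : ℝ} (hx : Tendsto x atTop (𝓝 x')) (hc : Tendsto c atTop (𝓝 c'))
    (h : ∀ n, Φ (x n) ≤ ENNReal.ofReal (c n)) : Φ x' ≤ ENNReal.ofReal c' := by
  refine le_of_forall_lt fun b hb => ?_
  obtain ⟨b', hbb', hb'⟩ := exists_between hb
  refine hbb'.trans_le (ge_of_tendsto ((ENNReal.continuous_ofReal.tendsto c').comp hc) ?_)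
  filter_upwards [hx.eventually (hΦ.lsc x' b' hb')] with n hn
  exact hn.le.trans (h n)

end IsDivergenceFunction

/-- `x` attains the supremum that defines `Φ*(y)`. -/
def IsConjugatePair (Φ : ℝ≥0 → ℝ≥0∞) (y : ℝ) (x : ℝ≥0) : Prop :=
  Φ x ≠ ⊤ ∧ fenchel Φ y = (x : ℝ) * y - (Φ x).toReal

namespace IsDivergenceFunction

theorem isConjugatePair_of_le (hΦ : IsDivergenceFunction Φ) {x : ℝ≥0} {y : ℝ}
    (h : Φ x ≤ ENNReal.ofReal (x * y - fenchel Φ y)) (h0 : 0 ≤ x * y - fenchel Φ y) :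
    IsConjugatePair Φ y x := by
  have hx : Φ x ≠ ⊤ := ne_top_of_le_ne_top ENNReal.ofReal_ne_top h
  have h1 := ENNReal.toReal_le_of_le_ofReal h0 h
  have h2 := hΦ.young hx y
  exact ⟨hx, by linarith⟩

/-- Superlinear growth keeps near-maximizers bounded, and lower semicontinuity of `Φ` passes to a
limit point. -/
theorem exists_isConjugatePair (hΦ : IsDivergenceFunction Φ) (y : ℝ) :
    ∃ x, IsConjugatePair Φ y x := by
  have hseq : ∀ n : ℕ, ∃ x : ℝ≥0, Φ x ≠ ⊤ ∧
      fenchel Φ y - 1 / ((n : ℝ) + 1) < (x : ℝ) * y - (Φ x).toReal := fun n =>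
    hΦ.exists_lt_sub (sub_lt_self _ Nat.one_div_pos_of_nat)
  choose x hx hxy using hseq
  have hev := hΦ.growth.eventually (lt_mem_nhds (b := (⊤ : ℝ≥0∞)) (a := ENNReal.ofReal (|y| + 1))
      ENNReal.ofReal_lt_top)
  obtain ⟨N, hN⟩ := eventually_atTop.1 hev
  -- Beyond `N` one has `Φ x ≥ (|y| + 1) x`, so `x y - Φ x ≤ -x`. Near-optimality up to `1` then
  -- forces `x ≤ 1 - Φ*(y)`.
  have hbd : ∀ n, x n ∈ Set.Icc 0 (max N (1 - fenchel Φ y).toNNReal) := by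
    intro n
    refine ⟨zero_le, ?_⟩
    rcases le_total (x n) N with h | h
    · exact h.trans (le_max_left _ _)
    · refine le_max_of_le_right (NNReal.le_toNNReal_of_coe_le ?_)
      have h1 : ENNReal.ofReal (|y| + 1) * (x n : ℝ≥0∞) ≤ Φ (x n) :=
        ENNReal.mul_le_of_le_div (hN _ h).le
      have h2 := ENNReal.toReal_mono (hx n) h1
      rw [ENNReal.toReal_mul, ENNReal.toReal_ofReal (by positivity), ENNReal.coe_toReal] at h2
      have h3 : (x n : ℝ) * y ≤ x n * |y| := mul_le_mul_of_nonneg_left (le_abs_self y) (x n).2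
      have h4 : 1 / ((n : ℝ) + 1) ≤ 1 := by
        rw [div_le_one (by positivity)]
        linarith [Nat.cast_nonneg (α := ℝ) n]
      have := hxy n
      nlinarith
  obtain ⟨x', -, φ, hφ, hlim⟩ := isCompact_Icc.tendsto_subseq hbd
  let c : ℕ → ℝ := fun n => (x (φ n) : ℝ) * y - fenchel Φ y + 1 / ((φ n : ℝ) + 1)
  have hc : Tendsto c atTop (𝓝 ((x' : ℝ) * y - fenchel Φ y + 0)) :=
    ((((NNReal.continuous_coe.tendsto x').comp hlim).mul_const y).sub_const _).add
      (tendsto_one_div_add_atTop_nhds_zero_nat.comp hφ.tendsto_atTop)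
  rw [add_zero] at hc
  have hle : ∀ n, (Φ (x (φ n))).toReal ≤ c n := by
    intro n
    have := hxy (φ n)
    simp only [c]
    linarith
  have h0 : 0 ≤ (x' : ℝ) * y - fenchel Φ y :=
    ge_of_tendsto' hc fun n => ENNReal.toReal_nonneg.trans (hle n)
  exact ⟨x', hΦ.isConjugatePair_of_le (hΦ.le_ofReal_of_tendsto hlim hc fun n =>
    (ENNReal.le_ofReal_iff_toReal_le (hx _) (ENNReal.toReal_nonneg.trans (hle n))).2 (hle n)) h0⟩

theorem convexOn_fenchel (hΦ : IsDivergenceFunction Φ) : ConvexOn ℝ Set.univ (fenchel Φ) := by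
  refine ⟨convex_univ, fun y _ y' _ a b ha hb hab => ?_⟩
  obtain ⟨x, hx, hxy⟩ := hΦ.exists_isConjugatePair (a • y + b • y')
  rw [hxy]
  have h1 := mul_le_mul_of_nonneg_left (hΦ.young hx y) ha
  have h2 := mul_le_mul_of_nonneg_left (hΦ.young hx y') hb
  have h3 : (Φ x).toReal = a * (Φ x).toReal + b * (Φ x).toReal := by
    rw [← add_mul, hab, one_mul]
  simp only [smul_eq_mul]
  nlinarith

theorem continuous_fenchel (hΦ : IsDivergenceFunction Φ) : Continuous (fenchel Φ) :=
  continuousOn_univ.1 (hΦ.convexOn_fenchel.continuousOn isOpen_univ)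

theorem monotone_fenchel (hΦ : IsDivergenceFunction Φ) : Monotone (fenchel Φ) := by
  intro y y' h
  obtain ⟨x, hx, hxy⟩ := hΦ.exists_isConjugatePair y
  have h1 := hΦ.young hx y'
  have h2 := mul_le_mul_of_nonneg_left h x.2
  change (x : ℝ) * y ≤ x * y' at h2
  linarith

theorem fenchel_nonneg (hΦ : IsDivergenceFunction Φ) {y : ℝ} (hy : 0 ≤ y) :
    0 ≤ fenchel Φ y := by
  refine le_trans ?_ (hΦ.monotone_fenchel hy)
  refine le_of_forall_pos_le_add fun ε hε => ?_
  have : ⨅ x, Φ x < ENNReal.ofReal ε := by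
    rw [hΦ.iInf_eq_zero]
    exact ENNReal.ofReal_pos.2 hε
  obtain ⟨x, hx⟩ := iInf_lt_iff.1 this
  have h1 := hΦ.young hx.ne_top 0
  have h2 := ENNReal.toReal_le_of_le_ofReal hε.le hx.le
  linarith

theorem neg_le_fenchel (hΦ : IsDivergenceFunction Φ) (y : ℝ) :
    -(Φ 0).toReal ≤ fenchel Φ y := by
  have := hΦ.young hΦ.zero_lt_top.ne y
  simp at this
  linarith

/-- Young's inequality at `x₀`. The slope exceeding `1` is what beats the term `-x` in the shifted
cost as `x → ∞`. -/
theorem exists_one_lt_mul_le (hΦ : IsDivergenceFunction Φ) :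
    ∃ a b : ℝ, 1 < a ∧ ∀ y, a * y ≤ b + fenchel Φ y := by
  obtain ⟨x, hx, hx'⟩ := hΦ.exists_lt_top
  exact ⟨x, (Φ x).toReal, by exact_mod_cast hx, hΦ.young hx'.ne⟩

/-- The graph of the subdifferential of `Φ*` is closed; this lets one-sided limits of a selection
remain conjugate points. -/
theorem isConjugatePair_of_tendsto (hΦ : IsDivergenceFunction Φ) {x : ℕ → ℝ≥0} {x' : ℝ≥0}
    {y : ℕ → ℝ} {y' : ℝ} (hx : Tendsto x atTop (𝓝 x')) (hy : Tendsto y atTop (𝓝 y'))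
    (h : ∀ n, IsConjugatePair Φ (y n) (x n)) : IsConjugatePair Φ y' x' := by
  have hc : Tendsto (fun n => (x n : ℝ) * y n - fenchel Φ (y n)) atTop
      (𝓝 ((x' : ℝ) * y' - fenchel Φ y')) :=
    (((NNReal.continuous_coe.tendsto x').comp hx).mul hy).sub
      ((hΦ.continuous_fenchel.tendsto y').comp hy)
  have heq : ∀ n, (Φ (x n)).toReal = (x n : ℝ) * y n - fenchel Φ (y n) := fun n => by
    rw [(h n).2]
    ring
  refine hΦ.isConjugatePair_of_le (hΦ.le_ofReal_of_tendsto hx hc fun n => ?_)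
    (ge_of_tendsto' hc fun n => (heq n) ▸ ENNReal.toReal_nonneg)
  rw [← heq, ENNReal.ofReal_toReal (h n).1]

end IsDivergenceFunction

namespace IsConjugatePair

/-- Monotonicity of the subdifferential: add the two crossed Young inequalities. -/
theorem le (hΦ : IsDivergenceFunction Φ) {y y' : ℝ} {x x' : ℝ≥0} (h : IsConjugatePair Φ y x)
    (h' : IsConjugatePair Φ y' x') (hy : y < y') : x ≤ x' := by
  have h1 := hΦ.young h.1 y'
  have h2 := hΦ.young h'.1 y
  have h3 := h.2
  have h4 := h'.2
  by_contra hlt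
  rw [not_le] at hlt
  have : (x' : ℝ) < x := by exact_mod_cast hlt
  nlinarith

/-- The difference quotients of `Φ*` are bounded by the conjugate points. -/
theorem mul_sub_le (hΦ : IsDivergenceFunction Φ) {y : ℝ} {x : ℝ≥0} (h : IsConjugatePair Φ y x)
    (y' : ℝ) : (x : ℝ) * (y' - y) ≤ fenchel Φ y' - fenchel Φ y := by
  have h1 := hΦ.young h.1 y'
  rw [h.2]
  linarith

/-- Convexity of the subdifferential, needed to adjust the mass of a candidate density to exactly
`1`. -/
theorem convexCombination (hΦ : IsDivergenceFunction Φ) {y : ℝ} {x x' : ℝ≥0}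
    (h : IsConjugatePair Φ y x) (h' : IsConjugatePair Φ y x') {a b : ℝ≥0} (hab : a + b = 1) :
    IsConjugatePair Φ y (a * x + b * x') := by
  have hle := hΦ.convex.2 (Set.mem_univ x) (Set.mem_univ x') zero_le zero_le hab
  simp only [smul_eq_mul, ENNReal.smul_def] at hle
  have hne : (a : ℝ≥0∞) * Φ x + b * Φ x' ≠ ⊤ :=
    ENNReal.add_ne_top.2 ⟨ENNReal.mul_ne_top ENNReal.coe_ne_top h.1,
      ENNReal.mul_ne_top ENNReal.coe_ne_top h'.1⟩
  have hfin : Φ (a * x + b * x') ≠ ⊤ := ne_top_of_le_ne_top hne hle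
  have hle' := ENNReal.toReal_mono hne hle
  rw [ENNReal.toReal_add (ENNReal.mul_ne_top ENNReal.coe_ne_top h.1)
    (ENNReal.mul_ne_top ENNReal.coe_ne_top h'.1), ENNReal.toReal_mul, ENNReal.toReal_mul,
    ENNReal.coe_toReal, ENNReal.coe_toReal] at hle'
  have hy := hΦ.young hfin y
  refine ⟨hfin, le_antisymm ?_ (by linarith)⟩
  have h1 : (a : ℝ) * fenchel Φ y = a * (x * y - (Φ x).toReal) := congrArg _ h.2
  have h2 : (b : ℝ) * fenchel Φ y = b * (x' * y - (Φ x').toReal) := congrArg _ h'.2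
  have hab' : (a : ℝ) + b = 1 := by exact_mod_cast hab
  have h3 : fenchel Φ y = a * fenchel Φ y + b * fenchel Φ y := by rw [← add_mul, hab', one_mul]
  push_cast
  nlinarith

/-- The divergence at a conjugate point is controlled by `Φ*`. -/
theorem toReal_le (hΦ : IsDivergenceFunction Φ) {y : ℝ} {x : ℝ≥0} (h : IsConjugatePair Φ y x) :
    (Φ x).toReal ≤ fenchel Φ (2 * y) - 2 * fenchel Φ y := by
  have h1 := hΦ.young h.1 (2 * y)
  have h2 := h.2
  nlinarith

end IsConjugatePair

end Fenchel

/-! ### The shifted expected cost `x ↦ E[Φ*(X + x)] - x` -/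

section ShiftedCost

variable {Ω : Type*} [MeasurableSpace Ω] {Φ : ℝ≥0 → ℝ≥0∞} {P : Measure Ω} {X : Ω → ℝ}

/-- The function `x ↦ E[Φ*(X + x)] - x`. -/
noncomputable def shiftedCost (Φ : ℝ≥0 → ℝ≥0∞) (P : Measure Ω) (X : Ω → ℝ) (x : ℝ) : ℝ :=
  ∫ ω, fenchel Φ (X ω + x) ∂P - x

theorem integrable_fenchel_mul_abs (hΦ : IsDivergenceFunction Φ) (hX : X ∈ orliczHeart Φ P)
    {c : ℝ} (hc : 0 < c) : Integrable (fun ω => fenchel Φ (c * |X ω|)) P := by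
  refine ⟨(hΦ.continuous_fenchel.measurable.comp_aemeasurable
    ((continuous_abs.measurable.comp_aemeasurable hX.1).const_mul c)).aestronglyMeasurable, ?_⟩
  rw [hasFiniteIntegral_iff_ofReal (Eventually.of_forall fun ω =>
    hΦ.fenchel_nonneg (mul_nonneg hc.le (abs_nonneg _)))]
  exact hX.2 c hc

/-- Convexity splits the argument into halves of `2c|X|` and `2|x|`. The doubled factor is why
membership in the heart is needed for every constant. -/
theorem integrable_fenchel_mul_add [IsFiniteMeasure P] (hΦ : IsDivergenceFunction Φ)
    (hX : X ∈ orliczHeart Φ P) {c : ℝ} (hc : 0 < c) (x : ℝ) :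
    Integrable (fun ω => fenchel Φ (c * X ω + x)) P := by
  have hm : AEStronglyMeasurable (fun ω => fenchel Φ (c * X ω + x)) P :=
    (hΦ.continuous_fenchel.measurable.comp_aemeasurable
      ((hX.1.const_mul c).add_const x)).aestronglyMeasurable
  have hi : Integrable (fun ω => (Φ 0).toReal + (fenchel Φ (2 * c * |X ω|) +
      fenchel Φ (2 * |x|))) P :=
    (integrable_const _).add ((integrable_fenchel_mul_abs hΦ hX (by positivity)).add
      (integrable_const _))
  refine hi.mono' hm (Eventually.of_forall fun ω => ?_)
  have h0 : 0 ≤ (Φ 0).toReal := ENNReal.toReal_nonneg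
  have h1 := hΦ.neg_le_fenchel (c * X ω + x)
  have h2 : 0 ≤ fenchel Φ (2 * c * |X ω|) := hΦ.fenchel_nonneg (by positivity)
  have h3 : 0 ≤ fenchel Φ (2 * |x|) := hΦ.fenchel_nonneg (by positivity)
  have h4 : c * X ω + x ≤ (1 / 2 : ℝ) • (2 * c * |X ω|) + (1 / 2 : ℝ) • (2 * |x|) := by
    have e1 := mul_le_mul_of_nonneg_left (le_abs_self (X ω)) hc.le
    have e2 := le_abs_self x
    simp only [smul_eq_mul]
    linarith
  have h5 := (hΦ.monotone_fenchel h4).trans (hΦ.convexOn_fenchel.2 (Set.mem_univ _)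
    (Set.mem_univ _) (by norm_num) (by norm_num) (by norm_num))
  simp only [smul_eq_mul] at h5
  rw [Real.norm_eq_abs, abs_le]
  constructor <;> linarith

theorem integrable_fenchel_add [IsFiniteMeasure P] (hΦ : IsDivergenceFunction Φ)
    (hX : X ∈ orliczHeart Φ P) (x : ℝ) : Integrable (fun ω => fenchel Φ (X ω + x)) P := by
  simpa using integrable_fenchel_mul_add hΦ hX one_pos x

theorem integrable_of_mem_orliczHeart [IsFiniteMeasure P] (hΦ : IsDivergenceFunction Φ)
    (hX : X ∈ orliczHeart Φ P) : Integrable X P := by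
  obtain ⟨a, b, ha, hab⟩ := hΦ.exists_one_lt_mul_le
  refine ((integrable_const b).add (integrable_fenchel_mul_abs hΦ hX one_pos)).mono'
    hX.1.aestronglyMeasurable (Eventually.of_forall fun ω => ?_)
  have := hab |X ω|
  have h0 := abs_nonneg (X ω)
  simp only [Pi.add_apply, one_mul, Real.norm_eq_abs]
  nlinarith

theorem convexOn_shiftedCost [IsFiniteMeasure P] (hΦ : IsDivergenceFunction Φ)
    (hX : X ∈ orliczHeart Φ P) : ConvexOn ℝ Set.univ (shiftedCost Φ P X) := by
  refine ⟨convex_univ, fun x _ y _ a b ha hb hab => ?_⟩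
  have hint : ∫ ω, fenchel Φ (X ω + (a • x + b • y)) ∂P ≤
      ∫ ω, (a * fenchel Φ (X ω + x) + b * fenchel Φ (X ω + y)) ∂P := by
    refine integral_mono (integrable_fenchel_add hΦ hX _)
      (((integrable_fenchel_add hΦ hX x).const_mul a).add
        ((integrable_fenchel_add hΦ hX y).const_mul b)) fun ω => ?_
    have h := hΦ.convexOn_fenchel.2 (Set.mem_univ (X ω + x)) (Set.mem_univ (X ω + y)) ha hb hab
    have he : X ω + (a • x + b • y) = a • (X ω + x) + b • (X ω + y) := by
      simp only [smul_eq_mul]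
      linear_combination (-X ω) * hab
    simp only [he]
    simpa using h
  rw [integral_add ((integrable_fenchel_add hΦ hX x).const_mul a)
        ((integrable_fenchel_add hΦ hX y).const_mul b), integral_const_mul,
    integral_const_mul] at hint
  simp only [shiftedCost, smul_eq_mul] at hint ⊢
  linarith

theorem continuous_shiftedCost [IsFiniteMeasure P] (hΦ : IsDivergenceFunction Φ)
    (hX : X ∈ orliczHeart Φ P) : Continuous (shiftedCost Φ P X) :=
  continuousOn_univ.1 ((convexOn_shiftedCost hΦ hX).continuousOn isOpen_univ)

theorem neg_sub_le_shiftedCost [IsProbabilityMeasure P] (hΦ : IsDivergenceFunction Φ)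
    (hX : X ∈ orliczHeart Φ P) (x : ℝ) : -(Φ 0).toReal - x ≤ shiftedCost Φ P X x := by
  have := integral_mono (integrable_const _) (integrable_fenchel_add hΦ hX x)
    fun ω => hΦ.neg_le_fenchel (X ω + x)
  simp only [integral_const, probReal_univ, one_smul] at this
  rw [shiftedCost]
  linarith

theorem mul_add_le_shiftedCost [IsProbabilityMeasure P] (hΦ : IsDivergenceFunction Φ)
    (hX : X ∈ orliczHeart Φ P) {a b : ℝ} (hab : ∀ y, a * y ≤ b + fenchel Φ y) (x : ℝ) :
    (a - 1) * x + a * ∫ ω, X ω ∂P - b ≤ shiftedCost Φ P X x := by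
  have hi := integrable_of_mem_orliczHeart hΦ hX
  have h := integral_mono (((hi.add (integrable_const x)).const_mul a).sub (integrable_const b))
    (integrable_fenchel_add hΦ hX x) fun ω => by
      have := hab (X ω + x)
      simp only [Pi.sub_apply, Pi.add_apply]
      linarith
  have h' : ∫ ω, (a * (X ω + x) - b) ∂P = a * (∫ ω, X ω ∂P + x) - b := by
    have hi' : Integrable (fun ω => X ω + x) P := hi.add (integrable_const x)
    rw [integral_sub (hi'.const_mul a) (integrable_const b), integral_const_mul,
      integral_add hi (integrable_const x)]
    simp
  have h'' : a * (∫ ω, X ω ∂P + x) - b ≤ ∫ ω, fenchel Φ (X ω + x) ∂P := h' ▸ h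
  rw [shiftedCost]
  linarith

/-- The bound `-Φ(0) - x` serves at `-∞`, the line of slope `a - 1 > 0` at `+∞`. -/
theorem tendsto_shiftedCost_cocompact [IsProbabilityMeasure P] (hΦ : IsDivergenceFunction Φ)
    (hX : X ∈ orliczHeart Φ P) : Tendsto (shiftedCost Φ P X) (cocompact ℝ) atTop := by
  obtain ⟨a, b, ha, hab⟩ := hΦ.exists_one_lt_mul_le
  rw [cocompact_eq_atBot_atTop]
  refine Tendsto.sup ?_ ?_
  · refine tendsto_atTop_mono (neg_sub_le_shiftedCost hΦ hX) ?_
    exact tendsto_atTop_add_const_left _ _ tendsto_neg_atBot_atTop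
  · refine tendsto_atTop_mono (fun x => mul_add_le_shiftedCost hΦ hX hab x) ?_
    have h1 : Tendsto (fun x : ℝ => (a - 1) * x) atTop atTop :=
      tendsto_id.const_mul_atTop (sub_pos.2 ha)
    exact tendsto_atTop_add_const_right _ _ (tendsto_atTop_add_const_right _ _ h1)

theorem exists_forall_shiftedCost_le [IsProbabilityMeasure P] (hΦ : IsDivergenceFunction Φ)
    (hX : X ∈ orliczHeart Φ P) : ∃ x, ∀ y, shiftedCost Φ P X x ≤ shiftedCost Φ P X y :=
  (continuous_shiftedCost hΦ hX).exists_forall_le (tendsto_shiftedCost_cocompact hΦ hX)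

theorem bddBelow_range_shiftedCost [IsProbabilityMeasure P] (hΦ : IsDivergenceFunction Φ)
    (hX : X ∈ orliczHeart Φ P) : BddBelow (Set.range (shiftedCost Φ P X)) := by
  obtain ⟨x, hx⟩ := exists_forall_shiftedCost_le hΦ hX
  exact ⟨_, Set.forall_mem_range.2 hx⟩

theorem isCompact_setOf_forall_shiftedCost_le [IsProbabilityMeasure P]
    (hΦ : IsDivergenceFunction Φ) (hX : X ∈ orliczHeart Φ P) :
    IsCompact {x | ∀ y, shiftedCost Φ P X x ≤ shiftedCost Φ P X y} := by
  have hclosed : IsClosed {x | ∀ y, shiftedCost Φ P X x ≤ shiftedCost Φ P X y} := by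
    simp only [Set.ofPred_forall]
    exact isClosed_iInter fun y => isClosed_le (continuous_shiftedCost hΦ hX) continuous_const
  have hev := (tendsto_shiftedCost_cocompact hΦ hX).eventually_gt_atTop (shiftedCost Φ P X 0)
  obtain ⟨K, hK, hKs⟩ := mem_cocompact.1 hev
  refine hK.of_isClosed_subset hclosed fun x hx => ?_
  by_contra hxK
  exact (hx 0).not_gt (hKs hxK)

end ShiftedCost

/-! ### Duality for the divergence risk measure -/

section Duality

variable {Ω : Type*} [MeasurableSpace Ω] {Φ : ℝ≥0 → ℝ≥0∞} {P : Measure Ω} {X : Ω → ℝ}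

/-- Weak duality: integrate Young's inequality between the density `q` and `X + x`; since `q` has
mass `1`, the shift contributes `x`. -/
theorem integral_sub_divergence_le [IsProbabilityMeasure P] (hΦ : IsDivergenceFunction Φ)
    (hX : X ∈ orliczHeart Φ P) {Q : Measure Ω} (hQ : Q ∈ divergenceSet Φ P) (x : ℝ) :
    ∫ ω, X ω ∂Q - (divergence Φ P Q).toReal ≤ shiftedCost Φ P X x := by
  obtain ⟨hQp, hQP, hdiv⟩ := hQ
  let q : Ω → ℝ≥0 := fun ω => (Q.rnDeriv P ω).toNNReal
  have hq : Measurable q := (Measure.measurable_rnDeriv Q P).ennreal_toNNReal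
  have hΦq : Measurable fun ω => Φ (q ω) := hΦ.lsc.measurable.comp hq
  have hfin : ∀ᵐ ω ∂P, Φ (q ω) < ⊤ := ae_lt_top hΦq hdiv.ne
  have hΦi : Integrable (fun ω => (Φ (q ω)).toReal) P :=
    integrable_toReal_of_lintegral_ne_top hΦq.aemeasurable hdiv.ne
  have hΦe : ∫ ω, (Φ (q ω)).toReal ∂P = (divergence Φ P Q).toReal :=
    integral_toReal hΦq.aemeasurable hfin
  have hqi : Integrable (fun ω => (q ω : ℝ)) P := Measure.integrable_toReal_rnDeriv
  have hq1 : ∫ ω, (q ω : ℝ) ∂P = 1 := by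
    refine (Measure.integral_toReal_rnDeriv hQP).trans ?_
    simp
  have hqX : ∫ ω, X ω ∂Q = ∫ ω, (q ω : ℝ) * X ω ∂P := by
    rw [← integral_rnDeriv_smul hQP]
    rfl
  -- Young's inequality at `|X|` shows that `X` is `Q`-integrable, so the Bochner integral is not a
  -- default `0`.
  have hqXi : Integrable (fun ω => (q ω : ℝ) * X ω) P := by
    refine (hΦi.add (integrable_fenchel_mul_abs hΦ hX one_pos)).mono'
      (hqi.aestronglyMeasurable.mul hX.1.aestronglyMeasurable) ?_
    filter_upwards [hfin] with ω hω
    have := hΦ.young hω.ne |X ω|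
    simpa [abs_mul] using this
  have hmono : ∫ ω, ((q ω : ℝ) * X ω + x * q ω) ∂P ≤
      ∫ ω, ((Φ (q ω)).toReal + fenchel Φ (X ω + x)) ∂P := by
    refine integral_mono_ae (hqXi.add (hqi.const_mul x))
      (hΦi.add (integrable_fenchel_add hΦ hX x)) ?_
    filter_upwards [hfin] with ω hω
    have := hΦ.young hω.ne (X ω + x)
    linarith
  rw [integral_add hqXi (hqi.const_mul x), integral_const_mul, hq1,
    integral_add hΦi (integrable_fenchel_add hΦ hX x), hΦe] at hmono
  rw [hqX, shiftedCost]
  linarith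

theorem exists_monotone_isConjugatePair (hΦ : IsDivergenceFunction Φ) :
    ∃ s : ℝ → ℝ≥0, Monotone s ∧ ∀ y, IsConjugatePair Φ y (s y) := by
  choose s hs using hΦ.exists_isConjugatePair
  refine ⟨s, fun y y' h => ?_, hs⟩
  rcases h.eq_or_lt with rfl | h
  · exact le_rfl
  · exact (hs y).le hΦ (hs y') h

/-- The subgradient inequality over a unit step bounds `s(X + x)` by `Φ*(X + x + 1) - Φ*(X + x)`. -/
theorem integrable_comp_isConjugatePair [IsFiniteMeasure P] (hΦ : IsDivergenceFunction Φ)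
    (hX : X ∈ orliczHeart Φ P) {s : ℝ → ℝ≥0} (hs : Monotone s)
    (hconj : ∀ y, IsConjugatePair Φ y (s y)) (x : ℝ) :
    Integrable (fun ω => (s (X ω + x) : ℝ)) P := by
  refine ((integrable_fenchel_add hΦ hX (x + 1)).sub (integrable_fenchel_add hΦ hX x)).mono'
    (hs.measurable.comp_aemeasurable (hX.1.add_const x)).coe_nnreal_real.aestronglyMeasurable
    (Eventually.of_forall fun ω => ?_)
  have := (hconj (X ω + x)).mul_sub_le hΦ (X ω + (x + 1))
  rw [show X ω + (x + 1) - (X ω + x) = 1 by ring, mul_one] at this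
  simpa using this

/-- Provides the one-sided limits of the selection along `X + x`: monotonicity gives pointwise
convergence, closedness of the graph gives conjugacy, and `s(X + x + 1)` dominates. -/
theorem exists_isConjugatePair_tendsto_integral [IsFiniteMeasure P]
    (hΦ : IsDivergenceFunction Φ) (hX : X ∈ orliczHeart Φ P) {s : ℝ → ℝ≥0} (hs : Monotone s)
    (hconj : ∀ y, IsConjugatePair Φ y (s y)) (x : ℝ) {h : ℕ → ℝ} (hh : Monotone h ∨ Antitone h)
    (hlim : Tendsto h atTop (𝓝 0)) (hle : ∀ n, h n ≤ 1) :
    ∃ b : Ω → ℝ≥0, AEMeasurable b P ∧ (∀ ω, IsConjugatePair Φ (X ω + x) (b ω)) ∧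
      Integrable (fun ω => (b ω : ℝ)) P ∧
      Tendsto (fun n => ∫ ω, (s (X ω + x + h n) : ℝ) ∂P) atTop (𝓝 (∫ ω, (b ω : ℝ) ∂P)) := by
  have hconv : ∀ ω, ∃ b : ℝ≥0, Tendsto (fun n => s (X ω + x + h n)) atTop (𝓝 b) := by
    intro ω
    rcases hh with hh | hh
    · refine ⟨_, tendsto_atTop_ciSup (fun m n hmn => hs (by linarith [hh hmn]))
        ⟨s (X ω + x + 1), ?_⟩⟩
      rintro _ ⟨n, rfl⟩
      exact hs (by linarith [hle n])
    · exact ⟨_, tendsto_atTop_ciInf (fun m n hmn => hs (by linarith [hh hmn]))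
        (OrderBot.bddBelow _)⟩
  choose b hb using hconv
  have hm : ∀ n, AEMeasurable (fun ω => s (X ω + x + h n)) P := fun n =>
    hs.measurable.comp_aemeasurable ((hX.1.add_const x).add_const (h n))
  have hbm : AEMeasurable b P := aemeasurable_of_tendsto_metrizable_ae atTop hm
    (Eventually.of_forall hb)
  have hint := integrable_comp_isConjugatePair hΦ hX hs hconj (x + 1)
  have hdom : ∀ n ω, s (X ω + x + h n) ≤ s (X ω + (x + 1)) := fun n ω =>
    hs (by linarith [hle n])
  refine ⟨b, hbm, fun ω => ?_, ?_, ?_⟩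
  · refine hΦ.isConjugatePair_of_tendsto (hb ω) ?_ fun n => hconj _
    simpa using hlim.const_add (X ω + x)
  · refine hint.mono' hbm.coe_nnreal_real.aestronglyMeasurable (Eventually.of_forall fun ω => ?_)
    simpa using le_of_tendsto' (hb ω) fun n => hdom n ω
  · refine tendsto_integral_of_dominated_convergence _
      (fun n => (hm n).coe_nnreal_real.aestronglyMeasurable) hint
      (fun n => Eventually.of_forall fun ω => ?_)
      (Eventually.of_forall fun ω => (NNReal.continuous_coe.tendsto _).comp (hb ω))
    simpa using hdom n ω

/-- First-order optimality without derivatives: compare the costs at `x` and `x + h`, and bound the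
increment by the subgradient at `X + x + h`. The sign of `h` decides whether the mean is at least or
at most `1`. -/
theorem mul_integral_ge_of_forall_shiftedCost_le [IsFiniteMeasure P]
    (hΦ : IsDivergenceFunction Φ) (hX : X ∈ orliczHeart Φ P) {s : ℝ → ℝ≥0} (hs : Monotone s)
    (hconj : ∀ y, IsConjugatePair Φ y (s y)) {x : ℝ}
    (hx : ∀ y, shiftedCost Φ P X x ≤ shiftedCost Φ P X y) (h : ℝ) :
    h ≤ h * ∫ ω, (s (X ω + x + h) : ℝ) ∂P := by
  have hi : Integrable (fun ω => (s (X ω + x + h) : ℝ)) P := by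
    simpa only [add_assoc] using integrable_comp_isConjugatePair hΦ hX hs hconj (x + h)
  have hmono := integral_mono ((integrable_fenchel_add hΦ hX (x + h)).sub
    (integrable_fenchel_add hΦ hX x)) (hi.const_mul h) fun ω => by
      have := (hconj (X ω + x + h)).mul_sub_le hΦ (X ω + x)
      simp only [Pi.sub_apply, ← add_assoc]
      linarith
  have hmono' : ∫ ω, (fenchel Φ (X ω + (x + h)) - fenchel Φ (X ω + x)) ∂P ≤
      ∫ ω, h * (s (X ω + x + h) : ℝ) ∂P := hmono
  rw [integral_sub (integrable_fenchel_add hΦ hX (x + h)) (integrable_fenchel_add hΦ hX x),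
    integral_const_mul] at hmono'
  have := hx (x + h)
  simp only [shiftedCost] at this
  linarith

/-- The optimally shifted variable admits a conjugate density. -/
theorem exists_isConjugatePair_integral_eq_one [IsFiniteMeasure P]
    (hΦ : IsDivergenceFunction Φ) (hX : X ∈ orliczHeart Φ P) {x : ℝ}
    (hx : ∀ y, shiftedCost Φ P X x ≤ shiftedCost Φ P X y) :
    ∃ q : Ω → ℝ≥0, AEMeasurable q P ∧ (∀ ω, IsConjugatePair Φ (X ω + x) (q ω)) ∧
      Integrable (fun ω => (q ω : ℝ)) P ∧ ∫ ω, (q ω : ℝ) ∂P = 1 := by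
  obtain ⟨s, hs, hconj⟩ := exists_monotone_isConjugatePair hΦ
  have hlim := tendsto_one_div_add_atTop_nhds_zero_nat (𝕜 := ℝ)
  have hanti : Antitone fun n : ℕ => 1 / ((n : ℝ) + 1) := fun m n hmn =>
    Nat.one_div_le_one_div hmn
  have hpos : ∀ n : ℕ, 0 < 1 / ((n : ℝ) + 1) := fun n => Nat.one_div_pos_of_nat
  obtain ⟨b, hbm, hbc, hbi, hbl⟩ := exists_isConjugatePair_tendsto_integral hΦ hX hs hconj x
    (Or.inr hanti) hlim fun n => by simpa using hanti (Nat.zero_le n)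
  obtain ⟨a, ham, hac, hai, hal⟩ := exists_isConjugatePair_tendsto_integral hΦ hX hs hconj x
    (h := fun n : ℕ => -(1 / ((n : ℝ) + 1))) (Or.inl fun m n hmn => neg_le_neg (hanti hmn))
    (by simpa using hlim.neg) fun n => by linarith [hpos n]
  have hb1 : 1 ≤ ∫ ω, (b ω : ℝ) ∂P := by
    refine ge_of_tendsto' hbl fun n => ?_
    have := mul_integral_ge_of_forall_shiftedCost_le hΦ hX hs hconj hx (1 / ((n : ℝ) + 1))
    nlinarith [hpos n]
  have ha1 : ∫ ω, (a ω : ℝ) ∂P ≤ 1 := by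
    refine le_of_tendsto' hal fun n => ?_
    have := mul_integral_ge_of_forall_shiftedCost_le hΦ hX hs hconj hx (-(1 / ((n : ℝ) + 1)))
    nlinarith [hpos n]
  -- The left limit has mass at most `1` and the right limit at least `1`, so suitable weights give
  -- mass exactly `1`.
  obtain ⟨l, r, hl, hr, hlr, h1⟩ :
      (1 : ℝ) ∈ segment ℝ (∫ ω, (a ω : ℝ) ∂P) (∫ ω, (b ω : ℝ) ∂P) := by
    rw [segment_eq_Icc (ha1.trans hb1)]
    exact ⟨ha1, hb1⟩
  lift l to ℝ≥0 using hl
  lift r to ℝ≥0 using hr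
  have hi : Integrable (fun ω => (l : ℝ) * (a ω : ℝ) + r * (b ω : ℝ)) P :=
    (hai.const_mul _).add (hbi.const_mul _)
  refine ⟨fun ω => l * a ω + r * b ω, (ham.const_mul l).add (hbm.const_mul r),
    fun ω => (hac ω).convexCombination hΦ (hbc ω) (by exact_mod_cast hlr), ?_, ?_⟩
  · simpa using hi
  · push_cast
    rw [integral_add (hai.const_mul _) (hbi.const_mul _), integral_const_mul, integral_const_mul]
    simpa using h1

/-- Attainment: for the measure with the conjugate density of mass `1`, Young's inequality is a
pointwise equality and integrates to the optimal cost. -/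
theorem exists_mem_divergenceSet_shiftedCost_eq [IsProbabilityMeasure P]
    (hΦ : IsDivergenceFunction Φ) (hX : X ∈ orliczHeart Φ P) {x : ℝ}
    (hx : ∀ y, shiftedCost Φ P X x ≤ shiftedCost Φ P X y) :
    ∃ Q ∈ divergenceSet Φ P, shiftedCost Φ P X x = ∫ ω, X ω ∂Q - (divergence Φ P Q).toReal := by
  obtain ⟨q, hqm, hqc, hqi, hq1⟩ := exists_isConjugatePair_integral_eq_one hΦ hX hx
  let Q := P.withDensity fun ω => (q ω : ℝ≥0∞)
  have hQ1 : ∫⁻ ω, (q ω : ℝ≥0∞) ∂P = 1 := by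
    rw [← ENNReal.toReal_eq_one_iff, ← hq1]
    have := integral_eq_lintegral_of_nonneg_ae (f := fun ω => (q ω : ℝ))
      (Eventually.of_forall fun ω => (q ω).2) hqi.aestronglyMeasurable
    rw [this]
    simp
  have hQp : IsProbabilityMeasure Q := ⟨by
    rw [withDensity_apply _ MeasurableSet.univ, Measure.restrict_univ, hQ1]⟩
  have hrn : Q.rnDeriv P =ᵐ[P] fun ω => (q ω : ℝ≥0∞) :=
    Measure.rnDeriv_withDensity₀ P hqm.coe_nnreal_ennreal
  have hdiv : divergence Φ P Q = ∫⁻ ω, Φ (q ω) ∂P := by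
    refine lintegral_congr_ae ?_
    filter_upwards [hrn] with ω hω
    rw [hω, ENNReal.toNNReal_coe]
  have hΦq : AEMeasurable (fun ω => Φ (q ω)) P := hΦ.lsc.measurable.comp_aemeasurable hqm
  -- Finite divergence follows from `Φ(q) ≤ Φ*(2y) - 2Φ*(y)` with `y = X + x`, the heart controlling
  -- the doubled argument.
  have hΦi : Integrable (fun ω => (Φ (q ω)).toReal) P := by
    have h2 : Integrable (fun ω => fenchel Φ (2 * (X ω + x))) P := by
      simpa only [mul_add] using integrable_fenchel_mul_add hΦ hX two_pos (2 * x)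
    refine (h2.sub ((integrable_fenchel_add hΦ hX x).const_mul 2)).mono'
      hΦq.ennreal_toReal.aestronglyMeasurable (Eventually.of_forall fun ω => ?_)
    rw [Real.norm_of_nonneg ENNReal.toReal_nonneg]
    exact (hqc ω).toReal_le hΦ
  have hfin : ∫⁻ ω, Φ (q ω) ∂P < ⊤ := by
    have := hΦi.lintegral_lt_top
    simpa only [ENNReal.ofReal_toReal (hqc _).1] using this
  have hdivr : (divergence Φ P Q).toReal = ∫ ω, (Φ (q ω)).toReal ∂P := by
    rw [hdiv, integral_toReal hΦq (Eventually.of_forall fun ω => (hqc ω).1.lt_top)]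
  have hqX : ∫ ω, X ω ∂Q = ∫ ω, (q ω : ℝ) * X ω ∂P :=
    integral_withDensity_eq_integral_smul₀ hqm X
  have hpt : ∀ ω, (q ω : ℝ) * X ω =
      fenchel Φ (X ω + x) + (Φ (q ω)).toReal - x * q ω := fun ω => by
    rw [(hqc ω).2]
    ring
  refine ⟨Q, ⟨hQp, withDensity_absolutelyContinuous _ _, hdiv ▸ hfin⟩, ?_⟩
  have hfi := integrable_fenchel_add hΦ hX x
  have hsum : Integrable (fun ω => fenchel Φ (X ω + x) + (Φ (q ω)).toReal) P := hfi.add hΦi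
  rw [hqX, hdivr, integral_congr_ae (Eventually.of_forall hpt),
    integral_sub hsum (hqi.const_mul x), integral_add hfi hΦi, integral_const_mul, hq1,
    shiftedCost]
  ring

theorem coe_sub_coe_ennreal {r : ℝ} {a : ℝ≥0∞} (ha : a ≠ ⊤) :
    (r : EReal) - (a : EReal) = ((r - a.toReal : ℝ) : EReal) := by
  lift a to ℝ≥0 using ha
  rfl

/-- The divergence risk measure is the optimal shifted cost. -/
theorem divergenceRisk_eq_iInf_shiftedCost [IsProbabilityMeasure P] (hΦ : IsDivergenceFunction Φ)
    (hX : X ∈ orliczHeart Φ P) :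
    divergenceRisk Φ P X = ((⨅ x, shiftedCost Φ P X x : ℝ) : EReal) := by
  obtain ⟨x, hx⟩ := exists_forall_shiftedCost_le hΦ hX
  have hinf : ⨅ x, shiftedCost Φ P X x = shiftedCost Φ P X x :=
    le_antisymm (ciInf_le (bddBelow_range_shiftedCost hΦ hX) x) (le_ciInf hx)
  rw [hinf]
  refine le_antisymm (iSup₂_le fun Q hQ => ?_) ?_
  · rw [coe_sub_coe_ennreal hQ.2.2.ne]
    exact EReal.coe_le_coe_iff.2 (integral_sub_divergence_le hΦ hX hQ x)
  · obtain ⟨Q, hQ, hQe⟩ := exists_mem_divergenceSet_shiftedCost_eq hΦ hX hx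
    rw [hQe, ← coe_sub_coe_ennreal hQ.2.2.ne]
    exact le_iSup₂ (f := fun Q _ => ((∫ ω, X ω ∂Q : ℝ) : EReal) - (divergence Φ P Q : EReal)) Q hQ

end Duality

/-! ### Law invariance and quantiles -/

section Law

variable {Ω Ω' : Type*} [MeasurableSpace Ω] [MeasurableSpace Ω'] {Φ : ℝ≥0 → ℝ≥0∞}
  {P : Measure Ω} {P' : Measure Ω'} {X : Ω → ℝ} {Y : Ω' → ℝ}

theorem shiftedCost_map (hΦ : IsDivergenceFunction Φ) (hX : AEMeasurable X P) :
    shiftedCost Φ (P.map X) id = shiftedCost Φ P X := by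
  ext x
  rw [shiftedCost, shiftedCost, integral_map hX]
  · rfl
  · exact (hΦ.continuous_fenchel.comp (continuous_id.add continuous_const)).aestronglyMeasurable

theorem mem_orliczHeart_iff_map (hΦ : IsDivergenceFunction Φ) (hX : AEMeasurable X P) :
    X ∈ orliczHeart Φ P ↔ id ∈ orliczHeart Φ (P.map X) := by
  have hm : ∀ c : ℝ, Measurable fun t : ℝ => ENNReal.ofReal (fenchel Φ (c * |id t|)) := fun c =>
    ENNReal.measurable_ofReal.comp (hΦ.continuous_fenchel.measurable.comp
      (continuous_const.mul continuous_abs).measurable)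
  refine ⟨fun h => ⟨aemeasurable_id, fun c hc => ?_⟩, fun h => ⟨hX, fun c hc => ?_⟩⟩
  · rw [lintegral_map' (hm c).aemeasurable hX]
    exact h.2 c hc
  · have := h.2 c hc
    rwa [lintegral_map' (hm c).aemeasurable hX] at this

theorem map_eq_map_of_distrFun_eq [IsProbabilityMeasure P] [IsProbabilityMeasure P']
    (hX : AEMeasurable X P) (hY : AEMeasurable Y P') (h : distrFun P X = distrFun P' Y) :
    P.map X = P'.map Y := by
  have := Measure.isProbabilityMeasure_map hX
  have := Measure.isProbabilityMeasure_map hY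
  refine Measure.ext_of_Iic _ _ fun t => ?_
  rw [Measure.map_apply_of_aemeasurable hX measurableSet_Iic,
    Measure.map_apply_of_aemeasurable hY measurableSet_Iic]
  exact (ENNReal.toReal_eq_toReal_iff' (measure_ne_top P _) (measure_ne_top P' _)).1 (congrFun h t)

/-- The risk functional at a distribution function is the optimal shifted cost of any variable in
the Orlicz heart with that distribution function. -/
theorem riskFunctional_distrFun [IsProbabilityMeasure P] (hΦ : IsDivergenceFunction Φ)
    (hX : X ∈ orliczHeart Φ P) :
    riskFunctional Φ P (distrFun P X) = ((⨅ x, shiftedCost Φ P X x : ℝ) : EReal) := by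
  have h : ∃ Y ∈ orliczHeart Φ P, distrFun P Y = distrFun P X := ⟨X, hX, rfl⟩
  -- The chosen representative is arbitrary, but the shifted cost sees only its law, which the
  -- distribution function determines.
  rw [riskFunctional, dif_pos h, divergenceRisk_eq_iInf_shiftedCost hΦ h.choose_spec.1,
    ← shiftedCost_map hΦ h.choose_spec.1.1,
    map_eq_map_of_distrFun_eq h.choose_spec.1.1 hX.1 h.choose_spec.2, shiftedCost_map hΦ hX.1]

/-- Right continuity of the distribution function makes the infimum attained; `0 < u < 1` makes the
set bounded below and nonempty, so `sInf` is no default value. -/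
theorem quantile_le_iff [IsProbabilityMeasure P] (hX : AEMeasurable X P) {u : ℝ}
    (hu : u ∈ Set.Ioo (0 : ℝ) 1) (t : ℝ) :
    quantile (distrFun P X) u ≤ t ↔ u ≤ distrFun P X t := by
  have := Measure.isProbabilityMeasure_map hX
  have hcdf : distrFun P X = cdf (P.map X) := by
    ext t
    rw [cdf_eq_real, measureReal_def, Measure.map_apply_of_aemeasurable hX measurableSet_Iic]
    rfl
  rw [hcdf]
  have hne : {t | u ≤ cdf (P.map X) t}.Nonempty :=
    ((tendsto_cdf_atTop (P.map X)).eventually (lt_mem_nhds hu.2)).exists.imp fun _ h => h.le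
  have hbdd : BddBelow {t | u ≤ cdf (P.map X) t} := by
    obtain ⟨b, hb⟩ := ((tendsto_cdf_atBot (P.map X)).eventually (gt_mem_nhds hu.1)).exists
    exact ⟨b, fun t ht => (not_lt.1 fun htb => (ht.trans ((monotone_cdf _) htb.le)).not_gt hb)⟩
  refine ⟨fun h => ?_, fun h => csInf_le hbdd h⟩
  have hgt : ∀ t' > t, u ≤ cdf (P.map X) t' := by
    intro t' ht'
    obtain ⟨r, hr, hrt⟩ := (csInf_lt_iff hbdd hne).1 (h.trans_lt ht')
    exact hr.trans (monotone_cdf _ hrt.le)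
  have hright : Tendsto (cdf (P.map X)) (𝓝[>] t) (𝓝 (cdf (P.map X) t)) :=
    ((cdf (P.map X)).right_continuous t).mono_left (nhdsWithin_mono _ Set.Ioi_subset_Ici_self)
  refine ge_of_tendsto hright ?_
  filter_upwards [self_mem_nhdsWithin] with t' ht'
  exact hgt t' ht'

theorem aemeasurable_quantile [IsProbabilityMeasure P] (hX : AEMeasurable X P) :
    AEMeasurable (quantile (distrFun P X)) (volume.restrict (Set.Ioo (0 : ℝ) 1)) := by
  refine aemeasurable_restrict_of_monotoneOn measurableSet_Ioo fun u hu v hv huv => ?_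
  exact (quantile_le_iff hX hu _).2 (huv.trans ((quantile_le_iff hX hv _).1 le_rfl))

/-- The quantile transform of the uniform distribution. -/
theorem map_quantile [IsProbabilityMeasure P] (hX : AEMeasurable X P) :
    (volume.restrict (Set.Ioo (0 : ℝ) 1)).map (quantile (distrFun P X)) = P.map X := by
  have : IsProbabilityMeasure (volume.restrict (Set.Ioo (0 : ℝ) 1)) := ⟨by simp⟩
  have hq := aemeasurable_quantile hX
  refine map_eq_map_of_distrFun_eq hq hX ?_
  ext t
  have h0 : 0 ≤ distrFun P X t := measureReal_nonneg
  have h1 : distrFun P X t ≤ 1 := measureReal_le_one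
  have hset : {u | quantile (distrFun P X) u ≤ t} ∩ Set.Ioo (0 : ℝ) 1 =
      Set.Iic (distrFun P X t) ∩ Set.Ioo (0 : ℝ) 1 := by
    ext u
    simp only [Set.mem_inter_iff, and_congr_left_iff]
    exact fun hu => quantile_le_iff hX hu t
  rw [distrFun, measureReal_def, Measure.restrict_apply' measurableSet_Ioo, hset,
    ← Measure.restrict_apply' measurableSet_Ioo, restrict_Ioo_eq_restrict_Ioc,
    Measure.restrict_apply' measurableSet_Ioc, Set.inter_comm, Set.Ioc_inter_Iic,
    min_eq_right h1]
  simp [h0]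

theorem certaintyEquivalent_eq_shiftedCost [IsProbabilityMeasure P] (hΦ : IsDivergenceFunction Φ)
    (hX : AEMeasurable X P) :
    certaintyEquivalent Φ (distrFun P X) = shiftedCost Φ P X := by
  rw [← shiftedCost_map hΦ hX, ← map_quantile hX, shiftedCost_map hΦ (aemeasurable_quantile hX)]
  rfl

theorem minimizerSet_nonempty_and_isCompact [IsProbabilityMeasure P]
    (hΦ : IsDivergenceFunction Φ) (hX : X ∈ orliczHeart Φ P) :
    (minimizerSet Φ (distrFun P X)).Nonempty ∧ IsCompact (minimizerSet Φ (distrFun P X)) := by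
  rw [minimizerSet, certaintyEquivalent_eq_shiftedCost hΦ hX.1]
  exact ⟨exists_forall_shiftedCost_le hΦ hX, isCompact_setOf_forall_shiftedCost_le hΦ hX⟩

end Law

/-! ### Infima of normal integrands over compact sets -/

section NormalIntegrand

variable {E K : Type*} [TopologicalSpace E] [PolishSpace E] [MeasurableSpace E] [BorelSpace E]
  [TopologicalSpace K] [PolishSpace K] [MeasurableSpace K] [BorelSpace K]

theorem exists_mem_sInf_image_eq {K : Type*} [TopologicalSpace K] {F : K → ℝ}
    (hF : LowerSemicontinuous F) {S : Set K} (hS : IsCompact S) (hne : S.Nonempty) :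
    ∃ k ∈ S, (∀ k' ∈ S, F k ≤ F k') ∧ sInf (F '' S) = F k := by
  obtain ⟨k, hk, hmin⟩ := (hF.lowerSemicontinuousOn S).exists_isMinOn hne hS
  refine ⟨k, hk, fun k' hk' => hmin hk', ?_⟩
  exact IsLeast.csInf_eq ⟨⟨k, hk, rfl⟩, by rintro _ ⟨k', hk', rfl⟩; exact hmin hk'⟩

theorem sInf_image_le {K : Type*} [TopologicalSpace K] {F : K → ℝ} (hF : LowerSemicontinuous F)
    {S : Set K} (hS : IsCompact S) {k : K} (hk : k ∈ S) : sInf (F '' S) ≤ F k := by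
  obtain ⟨k', -, hmin, heq⟩ := exists_mem_sInf_image_eq hF hS ⟨k, hk⟩
  rw [heq]
  exact hmin k hk

/-- The infimum over a compact set of a jointly Borel function that is lower semicontinuous in the
decision variable is Borel measurable. -/
theorem measurable_sInf_image {F : K → E → ℝ} (hF : Measurable (Function.uncurry F))
    (hlsc : ∀ z, LowerSemicontinuous fun k => F k z) {S : Set K} (hS : IsCompact S)
    (hne : S.Nonempty) : Measurable fun z => sInf ((fun k => F k z) '' S) := by
  refine measurable_of_Iic fun c => ?_
  -- Since the infimum is attained, its sublevel set is a projection of the joint sublevel set,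
  -- whose sections are closed.
  have heq : (fun z => sInf ((fun k => F k z) '' S)) ⁻¹' Set.Iic c =
      {z | ∃ k ∈ S, (z, k) ∈ {p : E × K | F p.2 p.1 ≤ c}} := by
    ext z
    constructor
    · intro hz
      obtain ⟨k, hk, -, he⟩ := exists_mem_sInf_image_eq (hlsc z) hS hne
      exact ⟨k, hk, he.symm.trans_le hz⟩
    · rintro ⟨k, hk, hkc⟩
      exact (sInf_image_le (hlsc z) hS hk).trans hkc
  rw [heq]
  refine measurableSet_exists_mem_of_isClosed_sections ?_ (fun z => ?_) hS
  · exact measurableSet_le (hF.comp measurable_swap) measurable_const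
  · exact (hlsc z).isClosed_preimage c

end NormalIntegrand

/-! ### The joint minimization over decisions and shifts -/

section Program

variable {T E : Type*} [MeasurableSpace E] {Φ : ℝ≥0 → ℝ≥0∞} {G : T → E → ℝ} {μ : Measure E}

theorem lowerSemicontinuous_fenchel_add [TopologicalSpace T] (hΦ : IsDivergenceFunction Φ)
    {g : T → ℝ} (hg : LowerSemicontinuous g) :
    LowerSemicontinuous fun p : T × ℝ => fenchel Φ (g p.1 + p.2) :=
  hΦ.continuous_fenchel.comp_lowerSemicontinuous
    ((hg.comp continuous_fst).add continuous_snd.lowerSemicontinuous) hΦ.monotone_fenchel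

theorem lowerSemicontinuous_fenchel_add_sub [TopologicalSpace T] (hΦ : IsDivergenceFunction Φ)
    {g : T → ℝ} (hg : LowerSemicontinuous g) :
    LowerSemicontinuous fun p : T × ℝ => fenchel Φ (g p.1 + p.2) - p.2 := by
  have h := (lowerSemicontinuous_fenchel_add hΦ hg).add
    (continuous_snd.neg.lowerSemicontinuous (f := fun p : T × ℝ => -p.2))
  exact h

theorem measurable_fenchel_add_sub_comp [MeasurableSpace T] {α : Type*} [MeasurableSpace α]
    (hΦ : IsDivergenceFunction Φ) (hG : Measurable (Function.uncurry G)) {u : α → T × ℝ}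
    {w : α → E} (hu : Measurable u) (hw : Measurable w) :
    Measurable fun a => fenchel Φ (G (u a).1 (w a) + (u a).2) - (u a).2 := by
  have h1 : Measurable fun a => G (u a).1 (w a) :=
    hG.comp ((measurable_fst.comp hu).prodMk hw)
  have h2 : Measurable fun a => (u a).2 := measurable_snd.comp hu
  exact (hΦ.continuous_fenchel.measurable.comp (h1.add h2)).sub h2

theorem shiftedCost_eq_integral_sub [IsProbabilityMeasure μ] (hΦ : IsDivergenceFunction Φ)
    {g : E → ℝ} (hg : g ∈ orliczHeart Φ μ) (x : ℝ) :
    shiftedCost Φ μ g x = ∫ z, (fenchel Φ (g z + x) - x) ∂μ := by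
  rw [integral_sub (integrable_fenchel_add hΦ hg x) (integrable_const x), shiftedCost]
  simp

/-- The shifted cost is coercive, uniformly over all variables whose means are bounded below. -/
theorem exists_forall_lt_shiftedCost (hΦ : IsDivergenceFunction Φ) (C M : ℝ) :
    ∃ R : ℝ, 0 ≤ R ∧ ∀ (μ : Measure E) [IsProbabilityMeasure μ] (g : E → ℝ),
      g ∈ orliczHeart Φ μ → -M ≤ ∫ z, g z ∂μ → ∀ x, R < |x| → C < shiftedCost Φ μ g x := by
  obtain ⟨a, b, ha, hab⟩ := hΦ.exists_one_lt_mul_le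
  -- The inner terms are the thresholds beyond which `-Φ(0) - x` (for `x ≤ 0`) and `(a - 1) x - a M
  -- - b` (for `x ≥ 0`) exceed `C`.
  refine ⟨max 0 (max (C + (Φ 0).toReal) ((C + a * M + b) / (a - 1))), le_max_left _ _, ?_⟩
  intro μ _ g hg hM x hx
  have h1 := neg_sub_le_shiftedCost hΦ hg x
  have h2 := mul_add_le_shiftedCost hΦ hg hab x
  have hx1 := ((le_max_left _ _).trans (le_max_right _ _)).trans_lt hx
  have hx2 := ((le_max_right _ _).trans (le_max_right _ _)).trans_lt hx
  rcases le_total 0 x with h0 | h0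
  · rw [abs_of_nonneg h0, div_lt_iff₀ (sub_pos.2 ha)] at hx2
    nlinarith
  · rw [abs_of_nonpos h0] at hx1
    linarith

theorem iInf_iInf_shiftedCost_eq [IsProbabilityMeasure μ] (hΦ : IsDivergenceFunction Φ)
    (hheart : ∀ θ, G θ ∈ orliczHeart Φ μ) {p : T × ℝ}
    (hp : ∀ q : T × ℝ, shiftedCost Φ μ (G p.1) p.2 ≤ shiftedCost Φ μ (G q.1) q.2) :
    ⨅ θ, ((⨅ x, shiftedCost Φ μ (G θ) x : ℝ) : EReal) = (shiftedCost Φ μ (G p.1) p.2 : EReal) := by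
  refine le_antisymm ((iInf_le _ p.1).trans ?_) (le_iInf fun θ => ?_)
  · exact EReal.coe_le_coe_iff.2 (ciInf_le (bddBelow_range_shiftedCost hΦ (hheart p.1)) p.2)
  · exact EReal.coe_le_coe_iff.2 (le_ciInf fun x => hp (θ, x))

/-- Each inner infimum is attained, so optimal decisions are the first components of jointly optimal
pairs, and compactness passes through the projection. -/
theorem setOf_forall_iInf_shiftedCost_le [IsProbabilityMeasure μ] (hΦ : IsDivergenceFunction Φ)
    (hheart : ∀ θ, G θ ∈ orliczHeart Φ μ) {p : T × ℝ}
    (hp : ∀ q : T × ℝ, shiftedCost Φ μ (G p.1) p.2 ≤ shiftedCost Φ μ (G q.1) q.2) :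
    {θ | ∀ θ', ⨅ x, shiftedCost Φ μ (G θ) x ≤ ⨅ x, shiftedCost Φ μ (G θ') x} =
      Prod.fst '' {q : T × ℝ | shiftedCost Φ μ (G q.1) q.2 ≤ shiftedCost Φ μ (G p.1) p.2} := by
  ext θ
  constructor
  · intro h
    obtain ⟨x, hx⟩ := exists_forall_shiftedCost_le hΦ (hheart θ)
    refine ⟨(θ, x), ?_, rfl⟩
    exact (le_ciInf hx).trans ((h p.1).trans
      (ciInf_le (bddBelow_range_shiftedCost hΦ (hheart p.1)) p.2))
  · rintro ⟨⟨θ, x⟩, hx, rfl⟩ θ'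
    exact (ciInf_le (bddBelow_range_shiftedCost hΦ (hheart θ)) x).trans
      (hx.trans (le_ciInf fun y => hp (θ', y)))

variable [MetricSpace T] [CompactSpace T] [MeasurableSpace T] [BorelSpace T]
  [TopologicalSpace E] [PolishSpace E] [BorelSpace E]

/-- Around every point the cost integrand has an integrable minorant whose integral is nearly the
expected cost. -/
theorem exists_local_minorant [IsProbabilityMeasure μ] (hΦ : IsDivergenceFunction Φ)
    (hG : Measurable (Function.uncurry G)) (hlsc : ∀ z, LowerSemicontinuous fun θ => G θ z)
    (hheart : ∀ θ, G θ ∈ orliczHeart Φ μ) (p : T × ℝ) {c : ℝ}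
    (hc : c < shiftedCost Φ μ (G p.1) p.2) :
    ∃ r > 0, ∃ g : E → ℝ, Measurable g ∧ Integrable g μ ∧ c < ∫ z, g z ∂μ ∧
      ∀ z, ∀ q ∈ Metric.closedBall p r, g z ≤ fenchel Φ (G q.1 z + q.2) - q.2 := by
  let h : T × ℝ → E → ℝ := fun p z => fenchel Φ (G p.1 z + p.2) - p.2
  have hh : ∀ z, LowerSemicontinuous fun p => h p z := fun z =>
    lowerSemicontinuous_fenchel_add_sub (g := fun θ => G θ z) hΦ (hlsc z)
  have hm : Measurable (Function.uncurry h) :=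
    measurable_fenchel_add_sub_comp hΦ hG measurable_fst measurable_snd
  let r : ℕ → ℝ := fun n => 1 / ((n : ℝ) + 1)
  have hr : ∀ n, 0 < r n := fun n => Nat.one_div_pos_of_nat
  have hr1 : ∀ n, r n ≤ 1 := fun n => by
    simpa [r] using Nat.one_div_le_one_div (α := ℝ) (Nat.zero_le n)
  have hcomp : ∀ n, IsCompact (Metric.closedBall p (r n)) := fun n =>
    isCompact_closedBall p (r n)
  have hmem : ∀ n, p ∈ Metric.closedBall p (r n) := fun n => Metric.mem_closedBall_self (hr n).le
  -- Infima over shrinking balls converge to `h p` by lower semicontinuity. They lie between a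
  -- constant and `h p`, so dominated convergence brings some integral above `c`.
  let g : ℕ → E → ℝ := fun n z => sInf ((fun q => h q z) '' Metric.closedBall p (r n))
  have hgm : ∀ n, Measurable (g n) := fun n => measurable_sInf_image hm hh (hcomp n) ⟨p, hmem n⟩
  have hgle : ∀ n z, ∀ q ∈ Metric.closedBall p (r n), g n z ≤ h q z := fun n z q hq =>
    sInf_image_le (hh z) (hcomp n) hq
  have hglow : ∀ n z, -(Φ 0).toReal - p.2 - 1 ≤ g n z := by
    intro n z
    obtain ⟨q, hq, -, he⟩ := exists_mem_sInf_image_eq (hh z) (hcomp n) ⟨p, hmem n⟩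
    change _ ≤ sInf _
    rw [he]
    have h1 := hΦ.neg_le_fenchel (G q.1 z + q.2)
    have h2 : |q.2 - p.2| ≤ 1 :=
      ((le_max_right _ _).trans (Metric.mem_closedBall.1 hq)).trans (hr1 n)
    have h3 := (abs_le.1 h2).2
    simp only [h]
    linarith
  have hi : Integrable (h p) μ := (integrable_fenchel_add hΦ (hheart p.1) p.2).sub
    (integrable_const _)
  have hbound : ∀ n z, ‖g n z‖ ≤ |h p z| + |-(Φ 0).toReal - p.2 - 1| := by
    intro n z
    have h1 := hgle n z p (hmem n)
    have h2 := hglow n z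
    rw [Real.norm_eq_abs, abs_le]
    have e1 := le_abs_self (h p z)
    have e2 := neg_abs_le (-(Φ 0).toReal - p.2 - 1)
    have e3 := abs_nonneg (h p z)
    have e4 := abs_nonneg (-(Φ 0).toReal - p.2 - 1)
    constructor <;> linarith
  have hbi : Integrable (fun z => |h p z| + |-(Φ 0).toReal - p.2 - 1|) μ :=
    hi.abs.add (integrable_const _)
  have hpt : ∀ z, Tendsto (fun n => g n z) atTop (𝓝 (h p z)) := by
    intro z
    refine tendsto_order.2 ⟨fun a ha => ?_, fun a ha =>
      Eventually.of_forall fun n => (hgle n z p (hmem n)).trans_lt ha⟩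
    obtain ⟨ε, hε, hball⟩ := Metric.eventually_nhds_iff_ball.1 (hh z p a ha)
    filter_upwards [(tendsto_one_div_add_atTop_nhds_zero_nat (𝕜 := ℝ)).eventually
      (gt_mem_nhds hε)] with n hn
    obtain ⟨q, hq, -, he⟩ := exists_mem_sInf_image_eq (hh z) (hcomp n) ⟨p, hmem n⟩
    change a < sInf _
    rw [he]
    exact hball q ((Metric.mem_closedBall.1 hq).trans_lt hn)
  have hlim : Tendsto (fun n => ∫ z, g n z ∂μ) atTop (𝓝 (∫ z, h p z ∂μ)) :=
    tendsto_integral_of_dominated_convergence _ (fun n => (hgm n).aestronglyMeasurable) hbi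
      (fun n => Eventually.of_forall (hbound n)) (Eventually.of_forall hpt)
  rw [shiftedCost_eq_integral_sub hΦ (hheart p.1)] at hc
  obtain ⟨n, hn⟩ := (hlim.eventually (lt_mem_nhds hc)).exists
  exact ⟨r n, hr n, g n, hgm n, hbi.mono' (hgm n).aestronglyMeasurable
    (Eventually.of_forall (hbound n)), hn, hgle n⟩

theorem lowerSemicontinuous_shiftedCost [IsProbabilityMeasure μ] (hΦ : IsDivergenceFunction Φ)
    (hG : Measurable (Function.uncurry G)) (hlsc : ∀ z, LowerSemicontinuous fun θ => G θ z)
    (hheart : ∀ θ, G θ ∈ orliczHeart Φ μ) :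
    LowerSemicontinuous fun p : T × ℝ => shiftedCost Φ μ (G p.1) p.2 := by
  intro p c hc
  obtain ⟨r, hr, g, -, hgi, hcg, hg⟩ := exists_local_minorant hΦ hG hlsc hheart p hc
  filter_upwards [Metric.closedBall_mem_nhds p hr] with q hq
  refine hcg.trans_le ?_
  rw [shiftedCost_eq_integral_sub hΦ (hheart q.1)]
  exact integral_mono hgi ((integrable_fenchel_add hΦ (hheart q.1) q.2).sub (integrable_const _))
    fun z => hg z q hq


/-- The common lower bound on the means makes coercivity uniform in `θ`, confining the shift to one
interval. -/
theorem isCompact_setOf_shiftedCost_le [IsProbabilityMeasure μ] (hΦ : IsDivergenceFunction Φ)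
    (hG : Measurable (Function.uncurry G)) (hlsc : ∀ z, LowerSemicontinuous fun θ => G θ z)
    (hheart : ∀ θ, G θ ∈ orliczHeart Φ μ) {M : ℝ} (hM : ∀ θ, -M ≤ ∫ z, G θ z ∂μ) (c : ℝ) :
    IsCompact {p : T × ℝ | shiftedCost Φ μ (G p.1) p.2 ≤ c} := by
  obtain ⟨R, -, hR⟩ := exists_forall_lt_shiftedCost (E := E) hΦ c M
  refine (isCompact_univ.prod (isCompact_Icc (a := -R) (b := R))).of_isClosed_subset
    ((lowerSemicontinuous_shiftedCost hΦ hG hlsc hheart).isClosed_preimage c) ?_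
  rintro ⟨θ, x⟩ hp
  refine ⟨Set.mem_univ _, abs_le.1 (not_lt.1 fun hx => ?_)⟩
  exact (hR μ (G θ) (hheart θ) (hM θ) x hx).not_ge hp

theorem exists_forall_shiftedCost_prod_le [Nonempty T] [IsProbabilityMeasure μ]
    (hΦ : IsDivergenceFunction Φ)
    (hG : Measurable (Function.uncurry G)) (hlsc : ∀ z, LowerSemicontinuous fun θ => G θ z)
    (hheart : ∀ θ, G θ ∈ orliczHeart Φ μ) {M : ℝ} (hM : ∀ θ, -M ≤ ∫ z, G θ z ∂μ) :
    ∃ p : T × ℝ, ∀ q : T × ℝ, shiftedCost Φ μ (G p.1) p.2 ≤ shiftedCost Φ μ (G q.1) q.2 := by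
  obtain ⟨θ₀⟩ := ‹Nonempty T›
  obtain ⟨p, hp, hmin⟩ := ((lowerSemicontinuous_shiftedCost hΦ hG hlsc hheart).lowerSemicontinuousOn
    {p : T × ℝ | shiftedCost Φ μ (G p.1) p.2 ≤ shiftedCost Φ μ (G θ₀) 0}).exists_isMinOn
    ⟨(θ₀, 0), le_refl (shiftedCost Φ μ (G θ₀) 0)⟩ (isCompact_setOf_shiftedCost_le hΦ hG hlsc hheart hM _)
  refine ⟨p, fun q => ?_⟩
  rcases le_total (shiftedCost Φ μ (G q.1) q.2) (shiftedCost Φ μ (G θ₀) 0) with h | h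
  · exact hmin h
  · exact le_trans hp h

end Program

/-! ### Empirical measures -/

section Empirical

variable {E : Type*} [MeasurableSpace E] {Φ : ℝ≥0 → ℝ≥0∞}

/-- The empirical measure of the first `n` points of a sequence. -/
noncomputable def empiricalMeasure (n : ℕ) (z : ℕ → E) : Measure E :=
  ∑ j ∈ Finset.range n, (n : ℝ≥0∞)⁻¹ • Measure.dirac (z j)

theorem isProbabilityMeasure_empiricalMeasure {n : ℕ} (hn : 1 ≤ n) (z : ℕ → E) :
    IsProbabilityMeasure (empiricalMeasure n z) := by
  refine ⟨?_⟩
  simp only [empiricalMeasure, Measure.finsetSum_apply, Measure.smul_apply, measure_univ,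
    smul_eq_mul, mul_one, Finset.sum_const, Finset.card_range, nsmul_eq_mul]
  exact ENNReal.mul_inv_cancel (by simpa using Nat.one_le_iff_ne_zero.1 hn)
    (ENNReal.natCast_ne_top n)

theorem lintegral_empiricalMeasure (n : ℕ) (z : ℕ → E) {g : E → ℝ≥0∞} (hg : Measurable g) :
    ∫⁻ e, g e ∂(empiricalMeasure n z) = ∑ j ∈ Finset.range n, (n : ℝ≥0∞)⁻¹ * g (z j) := by
  rw [empiricalMeasure, lintegral_finsetSum_measure]
  refine Finset.sum_congr rfl fun j _ => ?_
  rw [lintegral_smul_measure, lintegral_dirac' _ hg, smul_eq_mul]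

theorem integral_empiricalMeasure {n : ℕ} (hn : 1 ≤ n) (z : ℕ → E) {g : E → ℝ}
    (hg : Measurable g) :
    ∫ e, g e ∂(empiricalMeasure n z) = (∑ j ∈ Finset.range n, g (z j)) / n := by
  have hn' : (n : ℝ≥0∞)⁻¹ ≠ ⊤ := by simpa using Nat.one_le_iff_ne_zero.1 hn
  have hi : ∀ j, Integrable g ((n : ℝ≥0∞)⁻¹ • Measure.dirac (z j)) := fun j =>
    (integrable_dirac' hg.stronglyMeasurable (by simp)).smul_measure hn'
  rw [empiricalMeasure, integral_finsetSum_measure fun j _ => hi j, Finset.sum_div]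
  refine Finset.sum_congr rfl fun j _ => ?_
  rw [integral_smul_measure, integral_dirac' _ _ hg.stronglyMeasurable]
  simp [div_eq_inv_mul]

theorem mem_orliczHeart_empiricalMeasure (hΦ : IsDivergenceFunction Φ) {n : ℕ} (hn : 1 ≤ n)
    (z : ℕ → E) {g : E → ℝ} (hg : Measurable g) : g ∈ orliczHeart Φ (empiricalMeasure n z) := by
  refine ⟨hg.aemeasurable, fun c _ => ?_⟩
  have hm : Measurable fun e => ENNReal.ofReal (fenchel Φ (c * |g e|)) :=
    ENNReal.measurable_ofReal.comp (hΦ.continuous_fenchel.measurable.comp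
      ((continuous_abs.measurable.comp hg).const_mul c))
  rw [lintegral_empiricalMeasure n z hm]
  refine ENNReal.sum_lt_top.2 fun j _ => ENNReal.mul_lt_top ?_ ENNReal.ofReal_lt_top
  rw [ENNReal.inv_lt_top]
  exact_mod_cast hn

theorem shiftedCost_empiricalMeasure (hΦ : IsDivergenceFunction Φ) {n : ℕ} (hn : 1 ≤ n)
    (z : ℕ → E) {g : E → ℝ} (hg : Measurable g) (x : ℝ) :
    shiftedCost Φ (empiricalMeasure n z) g x =
      (∑ j ∈ Finset.range n, (fenchel Φ (g (z j) + x) - x)) / n := by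
  have hn' : (n : ℝ) ≠ 0 := by simpa using Nat.one_le_iff_ne_zero.1 hn
  have hm : Measurable fun e => fenchel Φ (g e + x) :=
    hΦ.continuous_fenchel.measurable.comp (hg.add_const x)
  rw [shiftedCost, integral_empiricalMeasure hn z hm, Finset.sum_sub_distrib, sub_div]
  simp [hn']

/-- Atomlessness realizes the empirical law by a variable in the heart, so the value is not the
default `⊤`. -/
theorem riskFunctional_empiricalDistrFun {Ω : Type*} [MeasurableSpace Ω] {P : Measure Ω}
    [IsProbabilityMeasure P] (hP : IsAtomless P) (hΦ : IsDivergenceFunction Φ) {n : ℕ}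
    (hn : 1 ≤ n) (z : ℕ → E) {g : E → ℝ} (hg : Measurable g) :
    riskFunctional Φ P (empiricalDistrFun n g z) =
      ((⨅ x, shiftedCost Φ (empiricalMeasure n z) g x : ℝ) : EReal) := by
  obtain ⟨X, hX, hmap⟩ := hP.exists_map_eq_sum_dirac hn fun j => g (z j)
  change P.map X = empiricalMeasure n fun j => g (z j) at hmap
  have hdist : empiricalDistrFun n g z = distrFun P X := by
    ext t
    have h1 : distrFun P X t = (P.map X).real (Set.Iic t) := by
      rw [measureReal_def, Measure.map_apply hX measurableSet_Iic]
      rfl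
    rw [h1, hmap, ← integral_indicator_one measurableSet_Iic, integral_empiricalMeasure hn _
      (measurable_one.indicator measurableSet_Iic), empiricalDistrFun, one_div, div_eq_inv_mul]
    rfl
  have hheart : X ∈ orliczHeart Φ P := by
    rw [mem_orliczHeart_iff_map hΦ hX.aemeasurable, hmap]
    exact mem_orliczHeart_empiricalMeasure hΦ hn _ measurable_id
  rw [hdist, riskFunctional_distrFun hΦ hheart, ← shiftedCost_map hΦ hX.aemeasurable, hmap]
  simp only [shiftedCost_empiricalMeasure hΦ hn _ measurable_id,
    shiftedCost_empiricalMeasure hΦ hn _ hg, id]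

end Empirical

/-! ### Sample average approximation -/

section SampleAverage

variable {T E : Type*} [MetricSpace T] [CompactSpace T] [MeasurableSpace T] [BorelSpace T]
  [TopologicalSpace E] [PolishSpace E] [MeasurableSpace E] [BorelSpace E]
  {Φ : ℝ≥0 → ℝ≥0∞} {G : T → E → ℝ}

theorem exists_forall_shiftedCost_empiricalMeasure_le [Nonempty T] (hΦ : IsDivergenceFunction Φ)
    (hG : Measurable (Function.uncurry G)) (hlsc : ∀ z, LowerSemicontinuous fun θ => G θ z)
    {ξ : E → ℝ} (hξ : ∀ z θ, |G θ z| ≤ ξ z) {n : ℕ} (hn : 1 ≤ n) (z : ℕ → E) :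
    ∃ p : T × ℝ, ∀ q : T × ℝ, shiftedCost Φ (empiricalMeasure n z) (G p.1) p.2 ≤
      shiftedCost Φ (empiricalMeasure n z) (G q.1) q.2 := by
  have := isProbabilityMeasure_empiricalMeasure hn z
  have hGm : ∀ θ, Measurable (G θ) := fun θ => hG.of_uncurry_left
  refine exists_forall_shiftedCost_prod_le hΦ hG hlsc
    (fun θ => mem_orliczHeart_empiricalMeasure hΦ hn z (hGm θ))
    (M := (∑ j ∈ Finset.range n, ξ (z j)) / n) fun θ => ?_
  rw [integral_empiricalMeasure hn z (hGm θ), ← neg_div, ← Finset.sum_neg_distrib]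
  gcongr with j hj
  exact (abs_le.1 (hξ (z j) θ)).1

/-- The optimal value of the sample average program is a Borel function of the sample. -/
theorem measurable_iInf_shiftedCost_empiricalMeasure [Nonempty T] (hΦ : IsDivergenceFunction Φ)
    (hG : Measurable (Function.uncurry G)) (hlsc : ∀ z, LowerSemicontinuous fun θ => G θ z)
    {ξ : E → ℝ} (hξ : ∀ z θ, |G θ z| ≤ ξ z) {n : ℕ} (hn : 1 ≤ n) :
    Measurable fun z : ℕ → E =>
      ⨅ p : T × ℝ, shiftedCost Φ (empiricalMeasure n z) (G p.1) p.2 := by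
  have hGm : ∀ θ, Measurable (G θ) := fun θ => hG.of_uncurry_left
  let F : T × ℝ → (ℕ → E) → ℝ := fun p z =>
    (∑ j ∈ Finset.range n, (fenchel Φ (G p.1 (z j) + p.2) - p.2)) / n
  have hF : ∀ z p, shiftedCost Φ (empiricalMeasure n z) (G p.1) p.2 = F p z := fun z p =>
    shiftedCost_empiricalMeasure hΦ hn z (hGm p.1) p.2
  have hFm : Measurable (Function.uncurry F) := by
    have hj : ∀ j, Measurable fun q : (T × ℝ) × (ℕ → E) =>
        fenchel Φ (G q.1.1 (q.2 j) + q.1.2) - q.1.2 := fun j =>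
      measurable_fenchel_add_sub_comp hΦ hG measurable_fst
        ((measurable_pi_apply j).comp measurable_snd)
    exact (Finset.measurable_fun_sum _ fun j _ => hj j).div_const _
  have hFl : ∀ z, LowerSemicontinuous fun p => F p z := by
    intro z
    have hpos : 0 ≤ (n : ℝ)⁻¹ := by positivity
    have hmono : Monotone fun t : ℝ => t * (n : ℝ)⁻¹ := fun s t hst =>
      mul_le_mul_of_nonneg_right hst hpos
    exact (continuous_mul_const (n : ℝ)⁻¹).comp_lowerSemicontinuous
      (lowerSemicontinuous_sum fun j _ =>
        lowerSemicontinuous_fenchel_add_sub (g := fun θ => G θ (z j)) hΦ (hlsc (z j))) hmono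
  obtain ⟨θ₀⟩ := ‹Nonempty T›
  have : Nonempty T := ⟨θ₀⟩
  -- The shift ranges over a noncompact line; an infimum lies strictly below `c` iff it does so on
  -- one of countably many compact windows.
  let S : ℕ → Set (T × ℝ) := fun N => Set.univ ×ˢ Set.Icc (-(N : ℝ)) N
  have hS : ∀ N, IsCompact (S N) := fun N => isCompact_univ.prod isCompact_Icc
  have hSne : ∀ N, (S N).Nonempty := fun N => ⟨(θ₀, 0), Set.mem_univ _, by simp⟩
  simp only [hF]
  have hbdd : ∀ z, BddBelow (Set.range fun p => F p z) := by
    intro z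
    obtain ⟨p, hp⟩ := exists_forall_shiftedCost_empiricalMeasure_le hΦ hG hlsc hξ hn z
    simp only [hF] at hp
    exact ⟨F p z, Set.forall_mem_range.2 hp⟩
  refine measurable_of_Iio fun c => ?_
  have heq : (fun z => ⨅ p, F p z) ⁻¹' Set.Iio c =
      ⋃ N, (fun z => sInf ((fun p => F p z) '' S N)) ⁻¹' Set.Iio c := by
    ext z
    simp only [Set.mem_preimage, Set.mem_Iio, Set.mem_iUnion]
    constructor
    · intro h
      obtain ⟨p, hp⟩ := exists_lt_of_ciInf_lt h
      obtain ⟨N, hN⟩ := exists_nat_ge |p.2|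
      exact ⟨N, (sInf_image_le (hFl z) (hS N) ⟨Set.mem_univ _, abs_le.1 hN⟩).trans_lt hp⟩
    · rintro ⟨N, hN⟩
      obtain ⟨p, -, -, he⟩ := exists_mem_sInf_image_eq (hFl z) (hS N) (hSne N)
      rw [he] at hN
      exact (ciInf_le (hbdd z) p).trans_lt hN
  rw [heq]
  exact MeasurableSet.iUnion fun N =>
    measurable_sInf_image hFm hFl (hS N) (hSne N) measurableSet_Iio

end SampleAverage

/-! ### The strong law and almost sure convergence of the optimal values -/

section StrongLaw

variable {Ω E : Type*} [MeasurableSpace Ω] [MeasurableSpace E] {P : Measure Ω}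
  {Z : Ω → E} {Zs : ℕ → Ω → E}

/-- The strong law of large numbers for functions of an i.i.d. sequence. -/
theorem ae_tendsto_sum_comp_div (hZs : ∀ j, Measurable (Zs j))
    (hindep : iIndepFun Zs P) (hident : ∀ j, IdentDistrib (Zs j) Z P P) {g : E → ℝ}
    (hg : Integrable g (P.map Z)) :
    ∀ᵐ ω ∂P, Tendsto (fun n : ℕ => (∑ j ∈ Finset.range n, g (Zs j ω)) / n) atTop
      (𝓝 (∫ z, g z ∂(P.map Z))) := by
  obtain ⟨g', hg', hgg'⟩ := hg.aestronglyMeasurable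
  have hg'm := hg'.measurable
  have hae : ∀ᵐ ω ∂P, ∀ j, g (Zs j ω) = g' (Zs j ω) := by
    refine ae_all_iff.2 fun j => ?_
    rw [← (hident j).map_eq] at hgg'
    exact ae_of_ae_map (hZs j).aemeasurable hgg'
  have hg'i : Integrable g' (P.map (Zs 0)) := by
    rw [(hident 0).map_eq]
    exact hg.congr hgg'
  have hlaw := strong_law_ae_real (μ := P) (fun j ω => g' (Zs j ω))
    (hg'i.comp_measurable (hZs 0))
    (fun i j hij => (hindep.indepFun hij).comp hg'm hg'm)
    (fun j => ((hident j).trans (hident 0).symm).comp hg'm)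
  have hint : ∫ z, g z ∂(P.map Z) = ∫ ω, g' (Zs 0 ω) ∂P := by
    rw [integral_congr_ae hgg', ← (hident 0).map_eq,
      integral_map (hZs 0).aemeasurable hg'.aestronglyMeasurable]
  filter_upwards [hae, hlaw] with ω h1 h2
  simp only [h1, hint]
  exact h2

variable {T : Type*} [MetricSpace T] [CompactSpace T] [MeasurableSpace T] [BorelSpace T]
  [TopologicalSpace E] [PolishSpace E] [BorelSpace E]
  {Φ : ℝ≥0 → ℝ≥0∞} {G : T → E → ℝ}

/-- A one-sided uniform law of large numbers. For shifts in `[-R, R]` finitely many local minorants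
obey the strong law; for larger shifts coercivity applies to the empirical measures themselves. -/
theorem ae_eventually_le_shiftedCost_empiricalMeasure [IsProbabilityMeasure P]
    (hΦ : IsDivergenceFunction Φ) (hZs : ∀ j, Measurable (Zs j)) (hZ : Measurable Z)
    (hindep : iIndepFun Zs P) (hident : ∀ j, IdentDistrib (Zs j) Z P P)
    (hG : Measurable (Function.uncurry G)) (hlsc : ∀ z, LowerSemicontinuous fun θ => G θ z)
    (hheart : ∀ θ, G θ ∈ orliczHeart Φ (P.map Z)) {ξ : E → ℝ} (hξi : Integrable ξ (P.map Z))
    (hξ : ∀ z θ, |G θ z| ≤ ξ z) {c : ℝ}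
    (hc : ∀ p : T × ℝ, c < shiftedCost Φ (P.map Z) (G p.1) p.2) :
    ∀ᵐ ω ∂P, ∀ᶠ n in atTop, ∀ p : T × ℝ,
      c ≤ shiftedCost Φ (empiricalMeasure n fun j => Zs j ω) (G p.1) p.2 := by
  have := Measure.isProbabilityMeasure_map hZ.aemeasurable (μ := P)
  have hGm : ∀ θ, Measurable (G θ) := fun θ => hG.of_uncurry_left
  -- The added `1` leaves room for the empirical mean of `ξ`, which is eventually below `E[ξ] + 1`.
  obtain ⟨R, -, hR⟩ := exists_forall_lt_shiftedCost (E := E) hΦ c (∫ z, ξ z ∂(P.map Z) + 1)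
  choose r hr g hgm hgi hcg hg using fun p =>
    exists_local_minorant hΦ hG hlsc hheart p (hc p)
  obtain ⟨t, ht⟩ := (isCompact_univ.prod (isCompact_Icc (a := -R) (b := R))).elim_nhds_subcover
    (fun p : T × ℝ => Metric.closedBall p (r p)) (fun p _ => Metric.closedBall_mem_nhds p (hr p))
  have hall : ∀ᵐ ω ∂P, ∀ p : t, Tendsto
      (fun n : ℕ => (∑ j ∈ Finset.range n, g p (Zs j ω)) / n) atTop
      (𝓝 (∫ z, g p z ∂(P.map Z))) :=
    ae_all_iff.2 fun p => ae_tendsto_sum_comp_div hZs hindep hident (hgi p)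
  filter_upwards [hall, ae_tendsto_sum_comp_div hZs hindep hident hξi] with ω h1 h2
  have h1' : ∀ᶠ n : ℕ in atTop, ∀ p : t, c < (∑ j ∈ Finset.range n, g p (Zs j ω)) / n :=
    eventually_all.2 fun p => (h1 p).eventually (lt_mem_nhds (hcg p))
  filter_upwards [h1', h2.eventually (gt_mem_nhds (lt_add_one _)), eventually_ge_atTop 1]
    with n hn1 hn2 hn q
  have := isProbabilityMeasure_empiricalMeasure hn fun j => Zs j ω
  by_cases hq : |q.2| ≤ R
  · obtain ⟨p, hp, hqp⟩ := Set.mem_iUnion₂.1 (ht.2 ⟨Set.mem_univ q.1, abs_le.1 hq⟩)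
    refine (hn1 ⟨p, hp⟩).le.trans ?_
    rw [shiftedCost_empiricalMeasure hΦ hn _ (hGm q.1)]
    gcongr with j hj
    exact hg p _ q hqp
  · refine (hR _ (G q.1) (mem_orliczHeart_empiricalMeasure hΦ hn _ (hGm q.1)) ?_ q.2
      (not_le.1 hq)).le
    rw [integral_empiricalMeasure hn _ (hGm q.1)]
    refine (neg_le_neg hn2.le).trans ?_
    rw [← neg_div, ← Finset.sum_neg_distrib]
    gcongr with j hj
    exact (abs_le.1 (hξ _ _)).1

/-- Almost sure convergence of the optimal values of the sample average programs. -/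
theorem ae_tendsto_iInf_shiftedCost_empiricalMeasure [IsProbabilityMeasure P]
    (hΦ : IsDivergenceFunction Φ) (hZs : ∀ j, Measurable (Zs j)) (hZ : Measurable Z)
    (hindep : iIndepFun Zs P) (hident : ∀ j, IdentDistrib (Zs j) Z P P)
    (hG : Measurable (Function.uncurry G)) (hlsc : ∀ z, LowerSemicontinuous fun θ => G θ z)
    (hheart : ∀ θ, G θ ∈ orliczHeart Φ (P.map Z)) {ξ : E → ℝ} (hξi : Integrable ξ (P.map Z))
    (hξ : ∀ z θ, |G θ z| ≤ ξ z) {p : T × ℝ}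
    (hp : ∀ q : T × ℝ, shiftedCost Φ (P.map Z) (G p.1) p.2 ≤ shiftedCost Φ (P.map Z) (G q.1) q.2) :
    ∀ᵐ ω ∂P, Tendsto (fun n : ℕ =>
        ⨅ q : T × ℝ, shiftedCost Φ (empiricalMeasure n fun j => Zs j ω) (G q.1) q.2) atTop
      (𝓝 (shiftedCost Φ (P.map Z) (G p.1) p.2)) := by
  have := Measure.isProbabilityMeasure_map hZ.aemeasurable (μ := P)
  have hGm : ∀ θ, Measurable (G θ) := fun θ => hG.of_uncurry_left
  have hne : Nonempty T := ⟨p.1⟩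
  set v := shiftedCost Φ (P.map Z) (G p.1) p.2 with hv
  have hlow : ∀ᵐ ω ∂P, ∀ k : ℕ, ∀ᶠ n in atTop, ∀ q : T × ℝ, v - 1 / ((k : ℝ) + 1) ≤
      shiftedCost Φ (empiricalMeasure n fun j => Zs j ω) (G q.1) q.2 :=
    ae_all_iff.2 fun k => ae_eventually_le_shiftedCost_empiricalMeasure hΦ hZs hZ hindep hident hG
      hlsc hheart hξi hξ fun q => (sub_lt_self v Nat.one_div_pos_of_nat).trans_le (hp q)
  -- The upper bound needs the strong law at a single optimal pair only.
  have hup := ae_tendsto_sum_comp_div hZs hindep hident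
    ((integrable_fenchel_add hΦ (hheart p.1) p.2).sub (integrable_const p.2))
  filter_upwards [hlow, hup] with ω h1 h2
  have h2' : Tendsto (fun n : ℕ => (∑ j ∈ Finset.range n,
      (fenchel Φ (G p.1 (Zs j ω) + p.2) - p.2)) / n) atTop (𝓝 v) := by
    rw [hv, shiftedCost_eq_integral_sub hΦ (hheart p.1)]
    exact h2
  refine tendsto_order.2 ⟨fun a ha => ?_, fun a ha => ?_⟩
  · obtain ⟨k, hk⟩ := exists_nat_one_div_lt (sub_pos.2 ha)
    filter_upwards [h1 k] with n hn
    exact (by linarith : a < v - 1 / ((k : ℝ) + 1)).trans_le (le_ciInf hn)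
  · filter_upwards [h2'.eventually (gt_mem_nhds ha), eventually_ge_atTop 1] with n hn hn1
    rw [← shiftedCost_empiricalMeasure hΦ hn1 _ (hGm p.1)] at hn
    obtain ⟨q, hq⟩ := exists_forall_shiftedCost_empiricalMeasure_le hΦ hG hlsc hξ hn1
      fun j => Zs j ω
    exact (ciInf_le ⟨_, Set.forall_mem_range.2 hq⟩ p).trans_lt hn

end StrongLaw

theorem mainTheorem3 {Ω : Type*} [MeasurableSpace Ω] (P : Measure Ω) [IsProbabilityMeasure P]
    (hP : IsAtomless P)
    (Φ : ℝ≥0 → ℝ≥0∞) (hΦ : IsDivergenceFunction Φ)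
    {m d : ℕ} (Θ : Set (EuclideanSpace ℝ (Fin m))) (hΘ : IsCompact Θ) (hΘne : Θ.Nonempty)
    (Z : Ω → EuclideanSpace ℝ (Fin d)) (hZ : Measurable Z)
    (Zs : ℕ → Ω → EuclideanSpace ℝ (Fin d)) (hZs : ∀ j, Measurable (Zs j))
    (hindep : iIndepFun Zs P) (hident : ∀ j, IdentDistrib (Zs j) Z P P)
    (G : Θ → EuclideanSpace ℝ (Fin d) → ℝ)
    -- (A 1)
    (hG : Measurable (Function.uncurry G))
    (hGlsc : ∀ z, LowerSemicontinuous (fun θ : Θ => G θ z))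
    -- (A 2)
    (hA2 : ∃ ξ₁ : EuclideanSpace ℝ (Fin d) → ℝ, Integrable ξ₁ (P.map Z) ∧
      ∀ z, ∀ θ : Θ, |G θ z| ≤ ξ₁ z)
    -- (A 3)
    (hA3 : ∀ θ : Θ, (fun ω => G θ (Zs 0 ω)) ∈ orliczHeart Φ P)
    (hA3' : ∃ ξ₂ : EuclideanSpace ℝ (Fin d) → ℝ, Integrable ξ₂ (P.map Z) ∧
      ∀ z, ∀ θ : Θ, |fenchel Φ (G θ z)| ≤ ξ₂ z) :
    -- the optimal values are real numbers `v` and `V n ω`, and the errors are random variables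
    (∃ (v : ℝ) (V : ℕ → Ω → ℝ),
      trueValue Φ P Θ G Z = (v : EReal) ∧
      (∀ n, 1 ≤ n → ∀ ω, saaValue Φ P Θ G n (fun j => Zs j ω) = (V n ω : EReal)) ∧
      ∀ n, 1 ≤ n → Measurable (fun ω => V n ω - v)) ∧
    -- nonvoid compact sets of minimizers
    ((argminRisk Φ P Θ G Z).Nonempty ∧ IsCompact (argminRisk Φ P Θ G Z) ∧
      ∀ θ : Θ, (minimizerSet Φ (distrFun P (fun ω => G θ (Z ω)))).Nonempty ∧
        IsCompact (minimizerSet Φ (distrFun P (fun ω => G θ (Z ω))))) ∧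
    -- almost sure convergence
    (∃ A : Set Ω, MeasurableSet A ∧ P A = 1 ∧ ∀ ω ∈ A,
      Tendsto (fun n : ℕ => saaValue Φ P Θ G n (fun j => Zs j ω)) atTop
        (𝓝 (trueValue Φ P Θ G Z))) := by
  have hcs : CompactSpace Θ := isCompact_iff_compactSpace.1 hΘ
  have hne : Nonempty Θ := hΘne.to_subtype
  have hprob := Measure.isProbabilityMeasure_map hZ.aemeasurable (μ := P)
  obtain ⟨ξ, hξi, hξ⟩ := hA2
  have hGm : ∀ θ, Measurable (G θ) := fun θ => hG.of_uncurry_left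
  have hmap : ∀ θ, (P.map Z).map (G θ) = P.map fun ω => G θ (Z ω) := fun θ =>
    Measure.map_map (hGm θ) hZ
  have hGZ : ∀ θ, Measurable fun ω => G θ (Z ω) := fun θ => (hGm θ).comp hZ
  -- Membership in the heart is assumed along the first sample point and transfers to `Z` by
  -- equality of laws.
  have hheartZ : ∀ θ, (fun ω => G θ (Z ω)) ∈ orliczHeart Φ P := fun θ => by
    have h0 := (mem_orliczHeart_iff_map hΦ ((hGm θ).comp (hZs 0)).aemeasurable).1 (hA3 θ)
    rw [((hident 0).comp (hGm θ)).map_eq] at h0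
    exact (mem_orliczHeart_iff_map hΦ (hGZ θ).aemeasurable).2 h0
  have hheart : ∀ θ, G θ ∈ orliczHeart Φ (P.map Z) := fun θ => by
    rw [mem_orliczHeart_iff_map hΦ (hGm θ).aemeasurable, hmap,
      ← mem_orliczHeart_iff_map hΦ (hGZ θ).aemeasurable]
    exact hheartZ θ
  have hrisk : ∀ θ, riskFunctional Φ P (distrFun P fun ω => G θ (Z ω)) =
      ((⨅ x, shiftedCost Φ (P.map Z) (G θ) x : ℝ) : EReal) := fun θ => by
    rw [riskFunctional_distrFun hΦ (hheartZ θ), ← shiftedCost_map hΦ (hGZ θ).aemeasurable,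
      ← hmap, shiftedCost_map hΦ (hGm θ).aemeasurable]
  have hM : ∀ θ, -∫ z, ξ z ∂(P.map Z) ≤ ∫ z, G θ z ∂(P.map Z) := fun θ => by
    rw [← integral_neg]
    exact integral_mono hξi.neg (integrable_of_mem_orliczHeart hΦ (hheart θ))
      fun z => (abs_le.1 (hξ z θ)).1
  obtain ⟨p, hp⟩ := exists_forall_shiftedCost_prod_le hΦ hG hGlsc hheart hM
  have htrue : trueValue Φ P Θ G Z = (shiftedCost Φ (P.map Z) (G p.1) p.2 : EReal) := by
    simp only [trueValue, hrisk]
    exact iInf_iInf_shiftedCost_eq hΦ hheart hp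
  let V : ℕ → Ω → ℝ := fun n ω =>
    ⨅ q : Θ × ℝ, shiftedCost Φ (empiricalMeasure n fun j => Zs j ω) (G q.1) q.2
  have hsaa : ∀ n, 1 ≤ n → ∀ ω, saaValue Φ P Θ G n (fun j => Zs j ω) = (V n ω : EReal) := by
    intro n hn ω
    have := isProbabilityMeasure_empiricalMeasure hn fun j => Zs j ω
    obtain ⟨q, hq⟩ := exists_forall_shiftedCost_empiricalMeasure_le hΦ hG hGlsc hξ hn
      fun j => Zs j ω
    have hV : V n ω = shiftedCost Φ (empiricalMeasure n fun j => Zs j ω) (G q.1) q.2 :=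
      le_antisymm (ciInf_le ⟨_, Set.forall_mem_range.2 hq⟩ q) (le_ciInf hq)
    simp only [saaValue, hV, riskFunctional_empiricalDistrFun hP hΦ hn _ (hGm _)]
    exact iInf_iInf_shiftedCost_eq hΦ
      (fun θ => mem_orliczHeart_empiricalMeasure hΦ hn _ (hGm θ)) hq
  have hargmin : argminRisk Φ P Θ G Z = Prod.fst '' {q : Θ × ℝ |
      shiftedCost Φ (P.map Z) (G q.1) q.2 ≤ shiftedCost Φ (P.map Z) (G p.1) p.2} := by
    rw [← setOf_forall_iInf_shiftedCost_le hΦ hheart hp]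
    simp only [argminRisk, hrisk, EReal.coe_le_coe_iff]
  refine ⟨⟨shiftedCost Φ (P.map Z) (G p.1) p.2, V, htrue, hsaa, fun n hn => ?_⟩,
    ⟨?_, ?_, fun θ => minimizerSet_nonempty_and_isCompact hΦ (hheartZ θ)⟩, ?_⟩
  · exact ((measurable_iInf_shiftedCost_empiricalMeasure hΦ hG hGlsc hξ hn).comp
      (measurable_pi_lambda _ hZs)).sub_const _
  · rw [hargmin]
    exact ⟨p.1, p, le_refl (shiftedCost Φ (P.map Z) (G p.1) p.2), rfl⟩
  · rw [hargmin]
    exact (isCompact_setOf_shiftedCost_le hΦ hG hGlsc hheart hM _).image continuous_fst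
  · have hae := ae_tendsto_iInf_shiftedCost_empiricalMeasure hΦ hZs hZ hindep hident hG hGlsc hheart
      hξi hξ hp
    -- The exceptional null set is enlarged to a measurable one.
    obtain ⟨N, hsub, hNm, hN⟩ := exists_measurable_superset_of_null (ae_iff.1 hae)
    refine ⟨Nᶜ, hNm.compl, (prob_compl_eq_one_iff hNm).2 hN, fun ω hω => ?_⟩
    rw [htrue]
    have hlim := (continuous_coe_real_ereal.tendsto _).comp
      (not_not.1 fun h => hω (hsub h))
    -- Only `n ≥ 1` matters: for `n = 0` the empirical function vanishes and is no distribution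
    -- function.
    refine hlim.congr' ?_
    filter_upwards [eventually_ge_atTop 1] with n hn
    exact (hsaa n hn ω).symm
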